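/- **Setting.** Let $I\subseteq\mathbb R$ be an interval with non-empty interior, $\Theta$ the Heaviside function ($\Theta(0)=1$), and for generalized functions of two times let $(f_2*f_1)(t',t)=\int f_2(t',\tau)f_1(\tau,t)\,d\tau$, with unit $1_*=\delta(t'-t)$. For an open interval $J$, generalized functions on $J\times J$ are understood through their $*$-action $\varphi\mapsto\int f(\cdot,\tau)\varphi(\tau)\,d\tau$ on the smooth functions on $J$ that vanish near the left end of $J$, and the $*$-product is the composition of the actions. A $*$-inverse on $J\times J$ is a generalized function $f^{*-1}=r_{-1}(t',t)\Theta+\sum_m r_m(t')\delta^{(m)}$ with smooth coefficients and $f^{*-1}*f=f*f^{*-1}=1_*$ there. It *exists almost everywhere* on $I$ if there is an open $U\subseteq I$ with $I\setminus U$ Lebesgue-null such that it exists on $J\times J$ for every open interval $J\subseteq U$. We write $u^{(j,l)}$ for the $j$-th $t'$-derivative and $l$-th $t$-derivative of $u(t',t)$. Let $\tilde f:I\times I\to\mathbb C$ be $C^\infty$ and separable, i.e. $\tilde f(t',t)=\sum_{i=1}^n a_i(t')b_i(t)$ for some $n$ and some functions $a_i,b_i$, and let $f=\tilde f(t',t)\,\Theta(t'-t)$.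 **(1)** Let $J\subseteq I$ be an open interval, $k\ge 0$, and $L=\sum_{j=0}^{k+1}\tilde g_j(t')\delta^{(j)}$ with $\tilde g_j$ smooth on $J$, $\sum_{j=0}^{k+1} \tilde g_j(t')\tilde f^{(j,0)}(t',t)=0$ on $J\times J$, and $\tilde f(\tau,\tau)\,\tilde g_{k+1}(\tau)\ne0$ for all $\tau\in J$. Then $f$ has a $*$-inverse on $J\times J$. If $k=0$, it is $f^{*-1}=\dfrac{1}{\tilde g_1(t')\tilde f(t',t')}L$. If $k>0$, put $$\tilde h_m(t)=\sum_{j=m+1}^{k+1}\sum_{\ell=m}^{j-1}\binom{\ell}{m}(-1)^\ell\tilde f^{(j-\ell-1,0)}(t,t)\,\tilde g_j^{(\ell-m)}(t);$$ the equation $\sum_{m=0}^k\tilde h_m(t)\tilde x^{(0,m)}(t',t)=0$ in $t$ with $\tilde x^{(0,j)}(t',t')=0$ for $0\le j\le k-2$ and $\tilde x^{(0,k-1)}(t',t')=-1/\tilde h_k(t')$ has exactly one solution $\tilde x$ on $J\times J$ that is smooth in $t$, this solution is smooth in both variables, and with $\tilde y_j(t',t)=\tilde x(t',t)\tilde g_j(t)$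 $$f^{*-1}=\tilde r_{-1}(t',t)\Theta+\sum_{m=0}^k\tilde r_m(t')\delta^{(m)},\quad \tilde r_{-1}=\sum_{j=0}^{k+1}(-1)^j\tilde y_j^{(0,j)},\quad \tilde r_m(t')=\sum_{j=m+1}^{k+1}(-1)^{j+m+1}\tilde y_j^{(0,j-1-m)}(t',t').$$ **(2)** Let $\tilde f(t',t)=\sum_{i=1}^{k+1}\tilde a_i(t)\tilde y_i(t')$ on $I\times I$ with $\tilde y_i$ smooth on $I$, let $W=W(\tilde y_1,\dots,\tilde y_{k+1})$ be the Wronskian, and let $L_W$ be the operator with $\tilde g_{k+1}=W$ and $\tilde g_0,\dots,\tilde g_k$ given by Cramer's rule for $\sum_{j\le k}\tilde y_i^{(j)}\tilde g_j=-W\tilde y_i^{(k+1)}$, $1\le i\le k+1$. Then on the interior of $I$ the operator $L_W$ has smooth coefficients and annihilates $\tilde f$. If moreover $\tilde f(\tau,\tau)W(\tau)\neq0$ for almost every $\tau\in I$, then $f^{*-1}$ exists almost everywhere and is given by (1) with $L=L_W$. **(3)** If $\tilde f$ is real-analytic on $I\times I$ and $\tilde f(t,t)$ is not identically null on $I$,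 then there is a decomposition as in (2) with $\tilde y_1,\dots,\tilde y_{k+1}$ real-analytic and linearly independent on $I$; its Wronskian is not identically null; and $f^{*-1}$ exists almost everywhere and is given by (1) with $L=L_W$. **(4)** If $\tilde f$ is real-analytic and not identically null on $I\times I$, then $f^{*-1}$ exists almost everywhere. **(5)** Consider, on an open interval $J\subseteq I$, the $*$-Lanczos algorithm with input $\mathsf A=\tilde{\mathsf A}(t')\Theta(t'-t)$, where $\tilde{\mathsf A}$ is an $N\times N$ matrix of smooth functions, and $w,v\in\mathbb C^N$ with $w^Hv=1$: $v_{-1}=w_{-1}=0$, $v_0=v1_*$, $w_0^H=w^H1_*$, and for $n\ge1$, $\alpha_{n-1}=w_{n-1}^H*\mathsf A*v_{n-1}$, $w_n^H=w_{n-1}^H*\mathsf A-\alpha_{n-1}*w_{n-1}^H-\beta_{n-1}*w_{n-2}^H$, $\beta_n=w_n^H*\mathsf A*v_{n-1}$, $v_n=(\mathsf A*v_{n-1}-v_{n-1}*\alpha_{n-1}-v_{n-2})*\beta_n^{*-1}$ (with $\beta_0:=0$). Suppose the algorithm reaches step $n\ge 1$ ($\beta_1,\dots,\beta_{n-1}$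 are $*$-invertible) and that $\beta_n$ has the conjectured form $\beta_n=\tilde\beta_n\Theta(t'-t)$ with $\tilde\beta_n$ separable and real-analytic on $J\times J$. Then there is no breakdown at step $n$ unless $\beta_n$ is identically null: if $\beta_n\neq0$, then $\beta_n^{*-1}$ exists almost everywhere on $J$. -/

import Mathlib

open scoped ContDiff

noncomputable section

namespace StarInverse

/-- The Heaviside function, with the convention `Θ(0) = 1`. -/
def heaviside (s : ℝ) : ℂ := if 0 ≤ s then 1 else 0

/-- `F(t',t)` is separable on `I × I`: a finite sum of products of a function of `t'` and a
function of `t`. -/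
def IsSeparableOn (F : ℝ → ℝ → ℂ) (I : Set ℝ) : Prop :=
  ∃ (n : ℕ) (a b : Fin n → ℝ → ℂ), ∀ t' ∈ I, ∀ t ∈ I, F t' t = ∑ i, a i t' * b i t

/-- `F^{(j,0)}(t',t)`, the `j`-th derivative in the first (left) time variable. -/
def leftDeriv (j : ℕ) (F : ℝ → ℝ → ℂ) (t' t : ℝ) : ℂ := iteratedDeriv j (fun s => F s t) t'

/-- `F^{(0,j)}(t',t)`, the `j`-th derivative in the second (right) time variable. -/
def rightDeriv (j : ℕ) (F : ℝ → ℝ → ℂ) (t' t : ℝ) : ℂ := iteratedDeriv j (fun s => F t' s) t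

/-- The functions on which the generalized functions on `J × J` act: smooth functions on the open
interval `J` that vanish near the left end of `J` (extended by `0` outside `J`). They include all
test functions on `J`, and the action of `f̃ Θ` maps them to functions of the same kind. -/
def CausalFun (J : Set ℝ) : Submodule ℂ (ℝ → ℂ) where
  carrier := {φ | ContDiffOn ℝ ∞ φ J ∧ (∀ t, t ∉ J → φ t = 0) ∧
    ∀ b ∈ J, ∃ c ∈ J, c ≤ b ∧ ∀ t < c, φ t = 0}
  zero_mem' := ⟨contDiffOn_const, fun _ _ => rfl, fun b hb => ⟨b, hb, le_rfl, fun _ _ => rfl⟩⟩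
  add_mem' := by
    rintro φ ψ ⟨h1, h2, h3⟩ ⟨k1, k2, k3⟩
    refine ⟨h1.add k1, fun t ht => by simp [h2 t ht, k2 t ht], fun b hb => ?_⟩
    obtain ⟨c, hc, hcb, hφ⟩ := h3 b hb
    obtain ⟨d, hd, hdc, hψ⟩ := k3 c hc
    exact ⟨d, hd, hdc.trans hcb, fun t ht => by simp [hφ t (ht.trans_le hdc), hψ t ht]⟩
  smul_mem' := by
    rintro z φ ⟨h1, h2, h3⟩
    refine ⟨contDiffOn_const.smul h1, fun t ht => by simp [h2 t ht], fun b hb => ?_⟩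
    obtain ⟨c, hc, hcb, hφ⟩ := h3 b hb
    exact ⟨c, hc, hcb, fun t ht => by simp [hφ t ht]⟩

/-- Generalized functions of `(t',t) ∈ J × J`, given by their `∗`-action on functions of the left
time variable, `φ ↦ ∫ G(t',τ) φ(τ) dτ`. The ring product (composition of actions) is the
`∗`-product `∫ G₂(t',τ) G₁(τ,t) dτ`, and the ring unit is `1_∗ = δ(t'-t)`. -/
abbrev GenFun (J : Set ℝ) : Type := Module.End ℂ (CausalFun J)

/-- The data of the generalized function
`reg(t',t) Θ(t'-t) + ∑_{m < order} sing_m(t') δ^{(m)}(t'-t)`. -/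
structure CausalKernel where
  reg : ℝ → ℝ → ℂ
  order : ℕ
  sing : ℕ → ℝ → ℂ

/-- All the coefficient functions are smooth on `J × J`, respectively on `J`. -/
def CausalKernel.SmoothOn (K : CausalKernel) (J : Set ℝ) : Prop :=
  ContDiffOn ℝ ∞ (Function.uncurry K.reg) (J ×ˢ J) ∧
    ∀ m < K.order, ContDiffOn ℝ ∞ (K.sing m) J

/-- `T` is the generalized function on `J × J` with kernel `K`, that is,
`(T ∗ φ)(t') = ∫ reg(t',τ) Θ(t'-τ) φ(τ) dτ + ∑_m sing_m(t') φ^{(m)}(t')`;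
recall that `∫ δ^{(m)}(t'-τ) φ(τ) dτ = φ^{(m)}(t')`. -/
def CausalKernel.Represents (K : CausalKernel) {J : Set ℝ} (T : GenFun J) : Prop :=
  ∀ φ : CausalFun J, ∀ t' ∈ J,
    (T φ : ℝ → ℂ) t' =
      (∫ τ in J, K.reg t' τ * heaviside (t' - τ) * (φ : ℝ → ℂ) τ) +
        ∑ m ∈ Finset.range K.order, K.sing m t' * iteratedDeriv m (φ : ℝ → ℂ) t'

/-- The kernel `F(t',t) Θ(t'-t)`. -/
def thetaKernel (F : ℝ → ℝ → ℂ) : CausalKernel := ⟨F, 0, fun _ _ => 0⟩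

/-- On `J × J`, `G` is the two-sided `∗`-inverse of `K`: both are generalized functions, `G` has
smooth coefficients, and `G ∗ K = K ∗ G = 1_∗`. -/
def IsStarInverse (J : Set ℝ) (K G : CausalKernel) : Prop :=
  G.SmoothOn J ∧ ∃ T S : GenFun J, K.Represents T ∧ G.Represents S ∧ S * T = 1 ∧ T * S = 1

/-- `L = ∑_{j=0}^{k+1} g_j(t') δ^{(j)}` has smooth coefficients on `J` and `L ∗ F = 0` on
`J × J`. -/
def IsAnnihilator (J : Set ℝ) (F : ℝ → ℝ → ℂ) (k : ℕ) (g : ℕ → ℝ → ℂ) : Prop :=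
  (∀ j ≤ k + 1, ContDiffOn ℝ ∞ (g j) J) ∧
    ∀ t' ∈ J, ∀ t ∈ J, ∑ j ∈ Finset.range (k + 2), g j t' * leftDeriv j F t' t = 0

/-- `h_m(t) = ∑_{j=m+1}^{k+1} ∑_{ℓ=m}^{j-1} (ℓ choose m) (-1)^ℓ F^{(j-ℓ-1,0)}(t,t) g_j^{(ℓ-m)}(t)`;
these are the functions with `L ∗ (F Θ) = ∑_{m=0}^k (-1)^m h_m(t) δ^{(m)}`. -/
def hCoeff (F : ℝ → ℝ → ℂ) (k : ℕ) (g : ℕ → ℝ → ℂ) (m : ℕ) (t : ℝ) : ℂ :=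
  ∑ j ∈ Finset.Icc (m + 1) (k + 1), ∑ l ∈ Finset.Icc m (j - 1),
    (l.choose m : ℂ) * (-1) ^ l * leftDeriv (j - l - 1) F t t * iteratedDeriv (l - m) (g j) t

/-- `x` solves, in the variable `t`, the equation `∑_{m=0}^k h_m(t) x^{(0,m)}(t',t) = 0` with
`x^{(0,j)}(t',t') = 0` for `j ≤ k - 2` and `x^{(0,k-1)}(t',t') = -1 / h_k(t')`. -/
def IsAdjointSolution (J : Set ℝ) (k : ℕ) (h : ℕ → ℝ → ℂ) (x : ℝ → ℝ → ℂ) : Prop :=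
  ∀ t' ∈ J, ContDiffOn ℝ ∞ (x t') J ∧
    (∀ t ∈ J, ∑ m ∈ Finset.range (k + 1), h m t * rightDeriv m x t' t = 0) ∧
    (∀ j, j + 1 < k → rightDeriv j x t' t' = 0) ∧
    rightDeriv (k - 1) x t' t' = -(h k t')⁻¹

/-- The kernel `r_{-1}(t',t) Θ + ∑_{m=0}^k r_m(t') δ^{(m)}` of `(x Θ) ∗ L`, where, with
`y_j(t',t) = x(t',t) g_j(t)`, `r_{-1} = ∑_{j=0}^{k+1} (-1)^j y_j^{(0,j)}` and
`r_m(t') = ∑_{j=m+1}^{k+1} (-1)^{j+m+1} y_j^{(0,j-1-m)}(t',t')`. -/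
def inverseKernel (k : ℕ) (g : ℕ → ℝ → ℂ) (x : ℝ → ℝ → ℂ) : CausalKernel where
  reg := fun t' t =>
    ∑ j ∈ Finset.range (k + 2), (-1) ^ j * rightDeriv j (fun s' s => x s' s * g j s) t' t
  order := k + 1
  sing := fun m t' =>
    ∑ j ∈ Finset.Icc (m + 1) (k + 1),
      (-1) ^ (j + m + 1) * rightDeriv (j - 1 - m) (fun s' s => x s' s * g j s) t' t'

/-- The kernel `L / (g_1(t') F(t',t'))`, for `L = g_0(t') δ + g_1(t') δ'`. -/
def inverseKernelZero (F : ℝ → ℝ → ℂ) (g : ℕ → ℝ → ℂ) : CausalKernel where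
  reg := fun _ _ => 0
  order := 2
  sing := fun m t' => (g 1 t' * F t' t')⁻¹ * g m t'

/-- On `J × J` the `∗`-inverse of `F Θ` exists and is the one computed from the operator
`L = ∑_{j=0}^{k+1} g_j(t') δ^{(j)}`; for `k > 0` this includes that the linear differential
equation for `x` has exactly one solution, and that it is smooth in both variables. -/
def StarInverseGivenBy (J : Set ℝ) (F : ℝ → ℝ → ℂ) (k : ℕ) (g : ℕ → ℝ → ℂ) : Prop :=
  (k = 0 → IsStarInverse J (thetaKernel F) (inverseKernelZero F g)) ∧
  (0 < k → ∃ x : ℝ → ℝ → ℂ,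
    IsAdjointSolution J k (hCoeff F k g) x ∧
    (∀ x', IsAdjointSolution J k (hCoeff F k g) x' → ∀ t' ∈ J, ∀ t ∈ J, x' t' t = x t' t) ∧
    ContDiffOn ℝ ∞ (Function.uncurry x) (J ×ˢ J) ∧
    IsStarInverse J (thetaKernel F) (inverseKernel k g x))

/-- The same outside a null set: on every open interval contained in an open subset of `I` of
full measure. -/
def StarInverseGivenByAE (I : Set ℝ) (F : ℝ → ℝ → ℂ) (k : ℕ) (g : ℕ → ℝ → ℂ) : Prop :=
  ∃ U ⊆ I, IsOpen U ∧ MeasureTheory.volume (I \ U) = 0 ∧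
    ∀ J ⊆ U, IsOpen J → J.OrdConnected → IsAnnihilator J F k g ∧ StarInverseGivenBy J F k g

/-- `F Θ` has, outside a null set, a `∗`-inverse of the form
`r_{-1}(t',t) Θ + ∑_m r_m(t') δ^{(m)}` with smooth coefficients. -/
def StarInvertibleAE (I : Set ℝ) (F : ℝ → ℝ → ℂ) : Prop :=
  ∃ U ⊆ I, IsOpen U ∧ MeasureTheory.volume (I \ U) = 0 ∧
    ∀ J ⊆ U, IsOpen J → J.OrdConnected → ∃ G, IsStarInverse J (thetaKernel F) G

/-- The matrix with rows `(y_i(t), y_i'(t), …, y_i^{(k)}(t))`. -/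
def wronskiMatrix {k : ℕ} (y : Fin (k + 1) → ℝ → ℂ) (t : ℝ) :
    Matrix (Fin (k + 1)) (Fin (k + 1)) ℂ :=
  Matrix.of fun i j => iteratedDeriv (j : ℕ) (y i) t

/-- The Wronskian `W(y_1, …, y_{k+1})`. -/
def wronskian {k : ℕ} (y : Fin (k + 1) → ℝ → ℂ) (t : ℝ) : ℂ := (wronskiMatrix y t).det

/-- The coefficients `g_0, …, g_{k+1}` with `g_{k+1} = W` and `g_0, …, g_k` the solution by
Cramer's rule of the linear system `∑_{j ≤ k} y_i^{(j)} g_j = -g_{k+1} y_i^{(k+1)}`. -/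
def wronskianOp {k : ℕ} (y : Fin (k + 1) → ℝ → ℂ) (j : ℕ) (t : ℝ) : ℂ :=
  if hj : j < k + 1 then
    -(Matrix.cramer (wronskiMatrix y t) (fun i => iteratedDeriv (k + 1) (y i) t) ⟨j, hj⟩)
  else wronskian y t

/-- The variables of the `∗`-Lanczos algorithm after step `n`: `v_{n-1}, v_n`, `w_{n-1}^H, w_n^H`
and `β_n`. -/
structure LanczosState (R : Type*) (N : ℕ) where
  vPrev : Fin N → R
  v : Fin N → R
  wPrev : Fin N → R
  w : Fin N → R
  β : R

/-- One step of the `∗`-Lanczos algorithm, over a ring whose product is the `∗`-product: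
`α_{n-1} = w_{n-1}^H A v_{n-1}`, `w_n^H = w_{n-1}^H A - α_{n-1} w_{n-1}^H - β_{n-1} w_{n-2}^H`,
`v̂_n = A v_{n-1} - v_{n-1} α_{n-1} - v_{n-2}`, `β_n = w_n^H A v_{n-1}`, `v_n = v̂_n β_n^{-1}`. -/
def lanczosStep {R : Type*} [Ring R] {N : ℕ} (A : Matrix (Fin N) (Fin N) R)
    (s : LanczosState R N) : LanczosState R N :=
  let α : R := s.w ⬝ᵥ A.mulVec s.v
  let w : Fin N → R := fun i => A.vecMul s.w i - α * s.w i - s.β * s.wPrev i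
  let vHat : Fin N → R := fun i => A.mulVec s.v i - s.v i * α - s.vPrev i
  let β : R := w ⬝ᵥ A.mulVec s.v
  { vPrev := s.v
    v := fun i => vHat i * Ring.inverse β
    wPrev := s.w
    w := w
    β := β }

/-- The `∗`-Lanczos algorithm with `v_{-1} = w_{-1} = 0`, `v_0 = v 1_∗`, `w_0^H = w^H 1_∗`
(`β_0`, which only multiplies `w_{-1}^H`, is set to `0`). -/
def lanczos {R : Type*} [Ring R] [Algebra ℂ R] {N : ℕ} (A : Matrix (Fin N) (Fin N) R)
    (w v : Fin N → ℂ) : ℕ → LanczosState R N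
  | 0 => { vPrev := 0
           v := fun i => algebraMap ℂ R (v i)
           wPrev := 0
           w := fun i => algebraMap ℂ R (star (w i))
           β := 0 }
  | n + 1 => lanczosStep A (lanczos A w v n)

/-- The algorithm arrives at step `n`: `β_1, …, β_{n-1}` are `∗`-invertible. -/
def LanczosReaches {R : Type*} [Ring R] [Algebra ℂ R] {N : ℕ} (A : Matrix (Fin N) (Fin N) R)
    (w v : Fin N → ℂ) (n : ℕ) : Prop :=
  ∀ m, 1 ≤ m → m < n → IsUnit (lanczos A w v m).β

end StarInverse

end

open scoped ContDiff

noncomputable section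

namespace StarInverse

open Set MeasureTheory Topology

/-! On causal functions, differentiation `D` and the causal primitive `P` are inverse to each other,
and a separable kernel acts as `∑ a_i P b_i`, where the factors stand for multiplications. A smooth
separable kernel has smooth factors, since they can be built from finitely many of its own rows and
columns. Every identity then follows from `D P = P D = 1` and Leibniz' rule.

Moving `D ^ n` through `F Θ` leaves `F^{(n,0)} Θ` and a jump term on the diagonal for each
derivative. If `L` annihilates `F`, the regular parts of `L ∗ (F Θ)` cancel and a differential
operator of order `k` remains, with leading coefficient `F(t,t) g_{k+1}(t)`. For `k = 0` it is a
multiplication and one divides. For `k > 0` it is inverted on the left by a Green's function `x Θ`: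
integration by parts puts all derivatives on `x`, the adjoint equation kills the integral, and the
Cauchy data of `x` on the diagonal kill every boundary term but one, which is the identity
(`sepOp_mul_diffOp_mul_sepOp`). So `(x Θ) ∗ L` is a left inverse of `F Θ`. It is two-sided because
`F Θ` acts surjectively when `F(t,t) ≠ 0`: a separable Volterra equation is, after one
differentiation, a linear differential system (`sepOp_surjective`).

An annihilating `L` comes from the Wronskian of the left factors by Cramer's rule. In the analytic
case these factors are linearly independent columns of `F`; the Wronskian of independent analytic
functions is not identically null (`exists_det_derivMatrix_ne_zero`), and zeros of non-null analytic
functions form null sets.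

If `F(t,t)` vanishes identically, then `D (F Θ) = F^{(1,0)} Θ`, so an inverse of `F^{(1,0)} Θ` times
`δ'` inverts `F Θ`. The reduction terminates, since a non-null analytic `F` has some `F^{(m,0)}(t,t)
≠ 0`. The claim on the `∗`-Lanczos algorithm is this last case applied to `β_n`. -/

/-! ### Linear differential equations on an open interval -/

/-- Two points of an open interval lie in a bounded open interval whose closure is in it. -/
lemma exists_Ioo_subset {J : Set ℝ} (hJ : IsOpen J) (hc : J.OrdConnected) {p q : ℝ}
    (hp : p ∈ J) (hq : q ∈ J) : ∃ a b, p ∈ Ioo a b ∧ q ∈ Ioo a b ∧ Icc a b ⊆ J := by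
  have hmin : min p q ∈ J := by rcases min_choice p q with h | h <;> rw [h] <;> assumption
  have hmax : max p q ∈ J := by rcases max_choice p q with h | h <;> rw [h] <;> assumption
  obtain ⟨a, ha, haJ⟩ : ∃ a < min p q, a ∈ J := by
    obtain ⟨l, hl, h⟩ := exists_Ioc_subset_of_mem_nhds (hJ.mem_nhds hmin) (exists_lt _)
    obtain ⟨a, ha⟩ := exists_between hl
    exact ⟨a, ha.2, h ⟨ha.1, ha.2.le⟩⟩
  obtain ⟨b, hb, hbJ⟩ : ∃ b > max p q, b ∈ J := by
    obtain ⟨l, hl, h⟩ := exists_Ico_subset_of_mem_nhds (hJ.mem_nhds hmax) (exists_gt _)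
    obtain ⟨b, hb⟩ := exists_between hl
    exact ⟨b, hb.1, h ⟨hb.1.le, hb.2⟩⟩
  refine ⟨a, b, ⟨ha.trans_le (min_le_left _ _), (le_max_left _ _).trans_lt hb⟩,
    ⟨ha.trans_le (min_le_right _ _), (le_max_right _ _).trans_lt hb⟩, hc.out haJ hbJ⟩

/-- The primitive of a continuous function on an open interval. -/
lemma hasDerivAt_integral_of_continuousOn {E : Type*} [NormedAddCommGroup E] [NormedSpace ℝ E]
    [CompleteSpace E] {J : Set ℝ} (hJ : IsOpen J) (hc : J.OrdConnected) {f : ℝ → E}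
    (hf : ContinuousOn f J) {c t : ℝ} (hcJ : c ∈ J) (ht : t ∈ J) :
    HasDerivAt (fun s => ∫ x in c..s, f x) (f t) t :=
  intervalIntegral.integral_hasDerivAt_right
    ((hf.mono (hc.uIcc_subset hcJ ht)).intervalIntegrable)
    (hf.stronglyMeasurableAtFilter hJ t ht) (hf.continuousAt (hJ.mem_nhds ht))

/-! ### Linear equations in a Banach space: the Peano–Baker series -/

section PeanoBaker

variable {E : Type*} [NormedAddCommGroup E] [NormedSpace ℝ E]

/-- The terms of the Peano–Baker series. -/
def peanoBaker (A : ℝ → E →L[ℝ] E) (c : ℝ) (u : ℝ → E) : ℕ → ℝ → E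
  | 0 => u
  | n + 1 => fun t => ∫ s in c..t, A s (peanoBaker A c u n s)

variable {J : Set ℝ} {A : ℝ → E →L[ℝ] E} {c : ℝ} {u : ℝ → E}

lemma continuousOn_peanoBaker [CompleteSpace E] (hJ : IsOpen J)
    (hc : J.OrdConnected) (hA : ContinuousOn A J)
    (hcJ : c ∈ J) (hu : ContinuousOn u J) (n : ℕ) : ContinuousOn (peanoBaker A c u n) J := by
  induction n with
  | zero => exact hu
  | succ n ih =>
    intro t ht
    exact (hasDerivAt_integral_of_continuousOn hJ hc (hA.clm_apply ih) hcJ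
      ht).continuousAt.continuousWithinAt

lemma hasDerivAt_peanoBaker [CompleteSpace E] (hJ : IsOpen J)
    (hc : J.OrdConnected) (hA : ContinuousOn A J)
    (hcJ : c ∈ J) (hu : ContinuousOn u J) (n : ℕ) {t : ℝ} (ht : t ∈ J) :
    HasDerivAt (peanoBaker A c u (n + 1)) (A t (peanoBaker A c u n t)) t :=
  hasDerivAt_integral_of_continuousOn hJ hc
    (hA.clm_apply (continuousOn_peanoBaker hJ hc hA hcJ hu n)) hcJ ht

/-- Each integration raises the power of `|t - c|` by one and divides by the new exponent, so the
terms are dominated by those of an exponential series whatever the length of `K`. -/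
lemma norm_peanoBaker_le {K : Set ℝ} (hK : K.OrdConnected) (hA : ContinuousOn A K)
    (hcK : c ∈ K) {M B : ℝ}
    (hcont : ∀ n, ContinuousOn (peanoBaker A c u n) K)
    (hM : ∀ t ∈ K, ‖A t‖ ≤ M) (hB : ∀ t ∈ K, ‖u t‖ ≤ B) (n : ℕ) :
    ∀ t ∈ K, ‖peanoBaker A c u n t‖ ≤ B * ((M * |t - c|) ^ n / n.factorial) := by
  have hM0 : 0 ≤ M := (norm_nonneg _).trans (hM c hcK)
  induction n with
  | zero => intro t ht; simpa [peanoBaker] using hB t ht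
  | succ n ih =>
    intro t ht
    have hsub : uIoc c t ⊆ K := uIoc_subset_uIcc.trans (hK.uIcc_subset hcK ht)
    have h1 : ∀ s ∈ uIoc c t, ‖A s (peanoBaker A c u n s)‖ ≤
        B * M ^ (n + 1) / n.factorial * |s - c| ^ n := by
      intro s hs
      calc ‖A s (peanoBaker A c u n s)‖ ≤ ‖A s‖ * ‖peanoBaker A c u n s‖ :=
            (A s).le_opNorm _
        _ ≤ M * (B * ((M * |s - c|) ^ n / n.factorial)) := by
            gcongr
            · exact hM s (hsub hs)
            · exact ih s (hsub hs)
        _ = B * M ^ (n + 1) / n.factorial * |s - c| ^ n := by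
            rw [mul_pow]; ring
    calc ‖peanoBaker A c u (n + 1) t‖
        ≤ ∫ s in uIoc c t, ‖A s (peanoBaker A c u n s)‖ :=
          intervalIntegral.norm_integral_le_integral_norm_uIoc
      _ ≤ ∫ s in uIoc c t, B * M ^ (n + 1) / n.factorial * |s - c| ^ n := by
          refine setIntegral_mono_on ?_ ?_ measurableSet_uIoc h1
          · exact intervalIntegrable_iff.1 (((hA.clm_apply (hcont n)).mono
              (hK.uIcc_subset hcK ht)).norm.intervalIntegrable)
          · exact intervalIntegrable_iff.1 (Continuous.intervalIntegrable (by fun_prop) _ _)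
      _ = B * ((M * |t - c|) ^ (n + 1) / (n + 1).factorial) := by
          rw [integral_const_mul, integral_pow_abs_sub_uIoc, Nat.factorial_succ, mul_pow]
          push_cast
          field_simp

/-- Solutions of a linear differential equation exist on the whole interval. -/
theorem exists_linear_ode_solution [CompleteSpace E] (hJ : IsOpen J)
    (hc : J.OrdConnected) (hA : ContinuousOn A J)
    (hcJ : c ∈ J) {b : ℝ → E} (hu : ∀ t ∈ J, HasDerivAt u (b t) t) :
    ∃ y : ℝ → E, y c = u c ∧ ∀ t ∈ J, HasDerivAt y (b t + A t (y t)) t := by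
  have huc : ContinuousOn u J := fun t ht => (hu t ht).continuousAt.continuousWithinAt
  set v := peanoBaker A c u with hv
  have hv0 : ∀ n, v (n + 1) c = 0 := fun n => by simp [hv, peanoBaker]
  refine ⟨fun t => u t + ∑' n, v (n + 1) t, by simp [hv0], fun t ht => ?_⟩
  -- `A` and `u` may be unbounded on `J`. Differentiability at `t` only needs a compact subinterval
  -- containing `c` and `t`, on which the series and its derived series are dominated.
  obtain ⟨p, q, hcpq, htpq, hpq⟩ := exists_Ioo_subset hJ hc hcJ ht
  obtain ⟨M, hM⟩ := isCompact_Icc.exists_bound_of_continuousOn (hA.mono hpq)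
  obtain ⟨B, hB⟩ := isCompact_Icc.exists_bound_of_continuousOn (huc.mono hpq)
  have hM0 : 0 ≤ M := (norm_nonneg _).trans (hM c (Ioo_subset_Icc_self hcpq))
  have hB0 : 0 ≤ B := (norm_nonneg _).trans (hB c (Ioo_subset_Icc_self hcpq))
  have hbound : ∀ n, ∀ s ∈ Ioo p q, ‖v n s‖ ≤ B * ((M * (q - p)) ^ n / n.factorial) := by
    intro n s hs
    refine (norm_peanoBaker_le ordConnected_Icc (hA.mono hpq)
      (Ioo_subset_Icc_self hcpq) (fun n => (continuousOn_peanoBaker hJ hc hA hcJ huc n).mono hpq)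
      hM hB n s (Ioo_subset_Icc_self hs)).trans ?_
    have : |s - c| ≤ q - p := by
      rw [abs_le]; constructor <;> linarith [hs.1, hs.2, hcpq.1, hcpq.2]
    gcongr
  have hsum : Summable fun n => B * ((M * (q - p)) ^ n / n.factorial) :=
    (Real.summable_pow_div_factorial _).mul_left _
  have hsv : ∀ s ∈ Ioo p q, Summable fun n => v n s := fun s hs =>
    .of_norm_bounded hsum fun n => hbound n s hs
  have hd := hasDerivAt_tsum_of_isPreconnected (hsum.mul_left M) isOpen_Ioo isPreconnected_Ioo
    (g := fun n => v (n + 1)) (g' := fun n s => A s (v n s))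
    (fun n s hs => hasDerivAt_peanoBaker hJ hc hA hcJ huc n (hpq (Ioo_subset_Icc_self hs)))
    (fun n s hs => ((A s).le_opNorm _).trans (mul_le_mul (hM s (Ioo_subset_Icc_self hs))
      (hbound n s hs) (norm_nonneg _) hM0)) hcpq (by simp [hv0]) htpq
  -- The solution is the sum of all `v n`, with `v 0 = u`, so the derived series resums to `A`
  -- applied to the solution.
  have h2 : ∑' n, A t (v n t) = A t (u t + ∑' n, v (n + 1) t) := by
    rw [← (A t).map_tsum (hsv t htpq), (hsv t htpq).tsum_eq_zero_add]
    rfl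
  rw [← h2]
  exact (hu t ht).add hd

/-- A solution of a homogeneous linear differential equation that vanishes at a point is null. -/
theorem linear_ode_eq_zero (hJ : IsOpen J) (hc : J.OrdConnected) (hA : ContinuousOn A J)
    (hcJ : c ∈ J) {y : ℝ → E} (hy : ∀ t ∈ J, HasDerivAt y (A t (y t)) t) (h0 : y c = 0) :
    ∀ t ∈ J, y t = 0 := by
  intro t ht
  obtain ⟨p, q, hcpq, htpq, hpq⟩ := exists_Ioo_subset hJ hc hcJ ht
  obtain ⟨M, hM⟩ := isCompact_Icc.exists_bound_of_continuousOn (hA.mono hpq)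
  have hsub : Ioo p q ⊆ J := Ioo_subset_Icc_self.trans hpq
  refine ODE_solution_unique_of_mem_Ioo (v := fun s x => A s x) (s := fun _ => univ)
    (K := M.toNNReal) (g := fun _ => 0) (fun s hs => ?_) hcpq
    (fun s hs => ⟨hy s (hsub hs), trivial⟩)
    (fun s _ => ⟨by simpa using hasDerivAt_const s (0 : E), trivial⟩) h0 htpq
  refine ((A s).lipschitz.weaken ?_).lipschitzOnWith
  rw [← NNReal.coe_le_coe]
  exact (hM s (Ioo_subset_Icc_self hs)).trans (Real.le_coe_toNNReal M)

end PeanoBaker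

/-! ### Linear systems with smooth coefficients -/

section System

variable {ι : Type*} [Fintype ι] {J : Set ℝ}

open Classical in
/-- The right-hand side of a linear system, as a family of continuous linear maps. -/
def systemCLM (A : ι → ι → ℝ → ℂ) (t : ℝ) : (ι → ℂ) →L[ℝ] (ι → ℂ) :=
  ∑ i, ∑ j, (A i j t) • ((ContinuousLinearMap.single ℝ (fun _ : ι => ℂ) i).comp
    (ContinuousLinearMap.proj j))

lemma systemCLM_apply (A : ι → ι → ℝ → ℂ) (t : ℝ) (v : ι → ℂ) (i : ι) :
    systemCLM A t v i = ∑ j, A i j t * v j := by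
  classical
  simp only [systemCLM, sum_apply, _root_.smul_apply,
    ContinuousLinearMap.comp_apply, Finset.sum_apply, Pi.smul_apply, smul_eq_mul,
    ContinuousLinearMap.single_apply, ContinuousLinearMap.proj_apply, Pi.single_apply]
  rw [Finset.sum_comm]
  simp

lemma continuousOn_systemCLM {A : ι → ι → ℝ → ℂ} (hA : ∀ i j, ContinuousOn (A i j) J) :
    ContinuousOn (systemCLM A) J :=
  continuousOn_finsetSum _ fun i _ => continuousOn_finsetSum _ fun j _ =>
    (hA i j).smul continuousOn_const

/-- A linear system with smooth coefficients has smooth solutions on the whole interval. -/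
theorem exists_system_solution (hJ : IsOpen J) (hc : J.OrdConnected) {A : ι → ι → ℝ → ℂ}
    (hA : ∀ i j, ContDiffOn ℝ ∞ (A i j) J) {r : ι → ℝ → ℂ} (hr : ∀ i, ContDiffOn ℝ ∞ (r i) J)
    {c : ℝ} (hcJ : c ∈ J) (y₀ : ι → ℂ) :
    ∃ y : ι → ℝ → ℂ, (∀ i, y i c = y₀ i) ∧ (∀ i, ContDiffOn ℝ ∞ (y i) J) ∧
      ∀ i, ∀ t ∈ J, HasDerivAt (y i) (∑ j, A i j t * y j t + r i t) t := by
  obtain ⟨y, hyc, hy⟩ := exists_linear_ode_solution (A := systemCLM A)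
    (u := fun t i => y₀ i + ∫ s in c..t, r i s) (b := fun t i => r i t) hJ hc
    (continuousOn_systemCLM fun i j => (hA i j).continuousOn) hcJ
    (fun t ht => hasDerivAt_pi.2 fun i => (hasDerivAt_integral_of_continuousOn hJ hc
      (hr i).continuousOn hcJ ht).const_add _)
  have hd : ∀ i, ∀ t ∈ J, HasDerivAt (fun s => y s i) (∑ j, A i j t * y t j + r i t) t := by
    intro i t ht
    have := hasDerivAt_pi.1 (hy t ht) i
    rwa [Pi.add_apply, systemCLM_apply, add_comm] at this
  -- Bootstrapping: the right-hand side of the equation is as regular as `y`, so `y` gains one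
  -- derivative at each turn.
  have hsm : ∀ n : ℕ, ∀ i, ContDiffOn ℝ n (fun s => y s i) J := by
    intro n
    induction n with
    | zero =>
      intro i
      exact contDiffOn_zero.2 fun t ht => (hd i t ht).continuousAt.continuousWithinAt
    | succ n ih =>
      intro i
      push_cast
      rw [contDiffOn_succ_iff_deriv_of_isOpen hJ]
      refine ⟨fun t ht => (hd i t ht).differentiableAt.differentiableWithinAt, by simp, ?_⟩
      refine ContDiffOn.congr ?_ fun t ht => (hd i t ht).deriv
      refine ContDiffOn.add (ContDiffOn.sum fun j _ => ?_) ((hr i).of_le (by exact_mod_cast le_top))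
      exact ((hA i j).of_le (by exact_mod_cast le_top)).mul (ih j)
  exact ⟨fun i s => y s i, fun i => by simp [hyc],
    fun i => contDiffOn_infty.2 fun n => hsm n i, hd⟩

theorem system_eq_zero (hJ : IsOpen J) (hc : J.OrdConnected) {A : ι → ι → ℝ → ℂ}
    (hA : ∀ i j, ContinuousOn (A i j) J) {c : ℝ} (hcJ : c ∈ J) {y : ι → ℝ → ℂ}
    (hy : ∀ i, ∀ t ∈ J, HasDerivAt (y i) (∑ j, A i j t * y j t) t) (h0 : ∀ i, y i c = 0) :
    ∀ i, ∀ t ∈ J, y i t = 0 := by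
  intro i t ht
  refine congrFun (linear_ode_eq_zero (A := systemCLM A) (y := fun t i => y i t) hJ hc
    (continuousOn_systemCLM hA) hcJ (fun t ht => ?_) (funext h0) t ht) i
  refine hasDerivAt_pi.2 fun i => ?_
  rw [systemCLM_apply]
  exact hy i t ht

end System

/-! ### Iterated derivatives of functions that are smooth on an open set -/

section Smooth

variable {J : Set ℝ} {f g : ℝ → ℂ}

lemma contDiffOn_deriv (hJ : IsOpen J) (hf : ContDiffOn ℝ ∞ f J) : ContDiffOn ℝ ∞ (deriv f) J :=
  ((contDiffOn_infty_iff_deriv_of_isOpen hJ).1 hf).2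

lemma contDiffOn_iteratedDeriv (hJ : IsOpen J) (hf : ContDiffOn ℝ ∞ f J) (n : ℕ) :
    ContDiffOn ℝ ∞ (iteratedDeriv n f) J := by
  induction n with
  | zero => simpa using hf
  | succ n ih => rw [iteratedDeriv_succ]; exact contDiffOn_deriv hJ ih

lemma hasDerivAt_of_contDiffOn (hJ : IsOpen J) (hf : ContDiffOn ℝ ∞ f J) {t : ℝ} (ht : t ∈ J) :
    HasDerivAt f (deriv f t) t :=
  ((hf.contDiffAt (hJ.mem_nhds ht)).differentiableAt (by simp)).hasDerivAt

lemma hasDerivAt_iteratedDeriv (hJ : IsOpen J) (hf : ContDiffOn ℝ ∞ f J) (n : ℕ) {t : ℝ}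
    (ht : t ∈ J) : HasDerivAt (iteratedDeriv n f) (iteratedDeriv (n + 1) f t) t := by
  rw [iteratedDeriv_succ]
  exact hasDerivAt_of_contDiffOn hJ (contDiffOn_iteratedDeriv hJ hf n) ht

lemma iteratedDeriv_congr_of_eqOn (hJ : IsOpen J) (h : EqOn f g J) (n : ℕ) :
    EqOn (iteratedDeriv n f) (iteratedDeriv n g) J := fun _ ht =>
  Filter.EventuallyEq.iteratedDeriv_eq n (h.eventuallyEq_of_mem (hJ.mem_nhds ht))

lemma iteratedDeriv_const_mul_sum {ι : Type*} (s : Finset ι) (c : ι → ℂ) {φ : ι → ℝ → ℂ}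
    (hJ : IsOpen J) (hφ : ∀ i ∈ s, ContDiffOn ℝ ∞ (φ i) J) (n : ℕ) {t : ℝ} (ht : t ∈ J) :
    iteratedDeriv n (fun x => ∑ i ∈ s, c i * φ i x) t = ∑ i ∈ s, c i * iteratedDeriv n (φ i) t := by
  have hφ' : ∀ i ∈ s, ContDiffAt ℝ n (φ i) t := fun i hi =>
    ((hφ i hi).contDiffAt (hJ.mem_nhds ht)).of_le (by exact_mod_cast le_top)
  rw [iteratedDeriv_fun_sum fun i hi => contDiffAt_const.mul (hφ' i hi)]
  exact Finset.sum_congr rfl fun i hi => iteratedDeriv_const_mul_field (c i) (φ i)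

lemma contDiffOn_det {ι : Type*} [Fintype ι] [DecidableEq ι] {S : Set ℝ} {M : ℝ → Matrix ι ι ℂ}
    (hM : ∀ i j, ContDiffOn ℝ ∞ (fun t => M t i j) S) : ContDiffOn ℝ ∞ (fun t => (M t).det) S := by
  simp only [Matrix.det_apply']
  exact ContDiffOn.sum fun σ _ => contDiffOn_const.mul (contDiffOn_prod fun i _ => hM _ _)

lemma contDiffOn_cramer {ι : Type*} [Fintype ι] [DecidableEq ι] {S : Set ℝ}
    {M : ℝ → Matrix ι ι ℂ} {b : ℝ → ι → ℂ}
    (hM : ∀ i j, ContDiffOn ℝ ∞ (fun t => M t i j) S)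
    (hb : ∀ i, ContDiffOn ℝ ∞ (fun t => b t i) S) (i : ι) :
    ContDiffOn ℝ ∞ (fun t => (M t).cramer (b t) i) S := by
  simp only [Matrix.cramer_apply]
  refine contDiffOn_det fun p q => ?_
  by_cases hq : q = i
  · subst hq; simpa using hb p
  · simpa [Matrix.updateCol_apply, hq] using hM p q

end Smooth

/-! ### Scalar linear differential equations of higher order -/

section Scalar

variable {J : Set ℝ} {k : ℕ} {h : ℕ → ℝ → ℂ}

/-- The companion system of `∑_{m ≤ k} h_m x^{(m)} = 0`. -/
def companion (k : ℕ) (h : ℕ → ℝ → ℂ) (i j : Fin k) (t : ℝ) : ℂ :=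
  if (i : ℕ) + 1 < k then (if (j : ℕ) = i + 1 then 1 else 0) else -(h k t)⁻¹ * h j t

lemma contDiffOn_companion (hh : ∀ m ≤ k, ContDiffOn ℝ ∞ (h m) J) (hk : ∀ t ∈ J, h k t ≠ 0)
    (i j : Fin k) : ContDiffOn ℝ ∞ (companion k h i j) J := by
  unfold companion
  by_cases hi : (i : ℕ) + 1 < k
  · simp only [hi, if_true]; exact contDiffOn_const
  · simp only [hi, if_false]
    exact (((hh k le_rfl).inv hk).neg).mul (hh j j.2.le)

lemma companion_sum_of_lt (i : Fin k) (hi : (i : ℕ) + 1 < k) (t : ℝ) (u : ℕ → ℂ) :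
    ∑ j : Fin k, companion k h i j t * u j = u (i + 1) := by
  rw [Finset.sum_eq_single ⟨i + 1, hi⟩]
  · simp [companion, hi]
  · intro j _ hj
    have : (j : ℕ) ≠ i + 1 := fun hj' => hj (Fin.ext hj')
    simp [companion, hi, this]
  · simp

lemma companion_sum_of_eq (i : Fin k) (hi : (i : ℕ) + 1 = k) (t : ℝ) (u : ℕ → ℂ) :
    ∑ j : Fin k, companion k h i j t * u j = -(h k t)⁻¹ * ∑ m ∈ Finset.range k, h m t * u m := by
  rw [← Fin.sum_univ_eq_sum_range (fun m => h m t * u m), Finset.mul_sum]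
  refine Finset.sum_congr rfl fun j _ => ?_
  simp [companion, hi, mul_assoc]

theorem exists_scalar_solution (hJ : IsOpen J) (hc : J.OrdConnected)
    (hh : ∀ m ≤ k, ContDiffOn ℝ ∞ (h m) J) (hk : ∀ t ∈ J, h k t ≠ 0) (hk0 : 0 < k) {c : ℝ}
    (hcJ : c ∈ J) (y₀ : Fin k → ℂ) :
    ∃ x : ℝ → ℂ, ContDiffOn ℝ ∞ x J ∧ (∀ j : Fin k, iteratedDeriv j x c = y₀ j) ∧
      ∀ t ∈ J, ∑ m ∈ Finset.range (k + 1), h m t * iteratedDeriv m x t = 0 := by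
  obtain ⟨y, hyc, hys, hyd⟩ := exists_system_solution hJ hc (contDiffOn_companion hh hk)
    (r := fun _ _ => 0) (fun _ => contDiffOn_const) hcJ y₀
  simp only [add_zero] at hyd
  have hder : ∀ (j : ℕ) (hj : j < k), EqOn (iteratedDeriv j (y ⟨0, hk0⟩)) (y ⟨j, hj⟩) J := by
    intro j
    induction j with
    | zero => intro hj t _; simp
    | succ j ih =>
      intro hj t ht
      rw [iteratedDeriv_succ, ((ih (by omega)).eventuallyEq_of_mem (hJ.mem_nhds ht)).deriv_eq,
        (hyd ⟨j, by omega⟩ t ht).deriv]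
      -- `companion_sum_of_lt` takes a sequence indexed by `ℕ`, so the components are padded with
      -- `0`; the index `j + 1 < k` does not meet the padding.
      have := companion_sum_of_lt (h := h) ⟨j, by omega⟩ hj t
        (fun m => if hm : m < k then y ⟨m, hm⟩ t else 0)
      simpa [hj] using this
  refine ⟨y ⟨0, hk0⟩, hys _, fun j => by rw [hder j j.2 hcJ, hyc], fun t ht => ?_⟩
  obtain ⟨n, rfl⟩ : ∃ n, k = n + 1 := ⟨k - 1, by omega⟩
  have hlast : iteratedDeriv (n + 1) (y ⟨0, hk0⟩) t = -(h (n + 1) t)⁻¹ *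
      ∑ m ∈ Finset.range (n + 1), h m t * iteratedDeriv m (y ⟨0, hk0⟩) t := by
    rw [iteratedDeriv_succ,
      ((hder n (by omega)).eventuallyEq_of_mem (hJ.mem_nhds ht)).deriv_eq,
      (hyd ⟨n, by omega⟩ t ht).deriv]
    rw [← companion_sum_of_eq (h := h) ⟨n, by omega⟩ rfl t
      (fun m => iteratedDeriv m (y ⟨0, hk0⟩) t)]
    exact Finset.sum_congr rfl fun j _ => by rw [hder j j.2 ht]
  rw [Finset.sum_range_succ, hlast]
  field_simp [hk t ht]
  ring

theorem scalar_eq_zero (hJ : IsOpen J) (hc : J.OrdConnected)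
    (hh : ∀ m ≤ k, ContDiffOn ℝ ∞ (h m) J) (hk : ∀ t ∈ J, h k t ≠ 0) (hk0 : 0 < k) {c : ℝ}
    (hcJ : c ∈ J) {x : ℝ → ℂ} (hx : ContDiffOn ℝ ∞ x J) (h0 : ∀ j < k, iteratedDeriv j x c = 0)
    (heq : ∀ t ∈ J, ∑ m ∈ Finset.range (k + 1), h m t * iteratedDeriv m x t = 0) :
    ∀ t ∈ J, x t = 0 := by
  intro t ht
  have := system_eq_zero hJ hc (fun i j => (contDiffOn_companion hh hk i j).continuousOn) hcJ
    (y := fun j : Fin k => iteratedDeriv j x) (fun i t ht => ?_) (fun i => h0 i i.2) ⟨0, hk0⟩ t ht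
  · simpa using this
  · have hd := hasDerivAt_iteratedDeriv hJ hx i ht
    convert hd using 1
    rcases Nat.lt_or_ge (i + 1) k with hi | hi
    · exact companion_sum_of_lt i hi t (fun m => iteratedDeriv m x t)
    · have hi : (i : ℕ) + 1 = k := by omega
      rw [companion_sum_of_eq i hi t (fun m => iteratedDeriv m x t), hi]
      have := heq t ht
      rw [Finset.sum_range_succ] at this
      rw [eq_neg_of_add_eq_zero_left this]
      field_simp [hk t ht]

/-- The equation for `x` has a solution, which is separable with smooth factors. -/
theorem exists_adjointSolution (hJ : IsOpen J) (hc : J.OrdConnected)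
    (hh : ∀ m ≤ k, ContDiffOn ℝ ∞ (h m) J) (hk : ∀ t ∈ J, h k t ≠ 0) (hk0 : 0 < k) :
    ∃ p q : Fin k → ℝ → ℂ, (∀ i, ContDiffOn ℝ ∞ (p i) J) ∧ (∀ i, ContDiffOn ℝ ∞ (q i) J) ∧
      IsAdjointSolution J k h (fun t' t => ∑ i, p i t' * q i t) := by
  rcases J.eq_empty_or_nonempty with rfl | ⟨c, hcJ⟩
  · exact ⟨0, 0, fun _ => by simp [contDiffOn_empty], fun _ => by simp [contDiffOn_empty],
      fun t ht => absurd ht (by simp)⟩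
  -- A fundamental system, with unit Cauchy data at `c`.
  choose q hqs hqc hqe using fun i : Fin k =>
    exists_scalar_solution hJ hc hh hk hk0 hcJ (Pi.single i (1 : ℂ))
  let Q : ℝ → Matrix (Fin k) (Fin k) ℂ := fun t => Matrix.of fun j i => iteratedDeriv j (q i) t
  have hQs : ∀ i j, ContDiffOn ℝ ∞ (fun t => Q t i j) J := fun i j =>
    contDiffOn_iteratedDeriv hJ (hqs j) i
  have hcomb : ∀ (v : Fin k → ℂ) (n : ℕ), ∀ t ∈ J,
      iteratedDeriv n (fun s => ∑ i, v i * q i s) t = ∑ i, v i * iteratedDeriv n (q i) t :=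
    fun v n t ht => iteratedDeriv_const_mul_sum _ v hJ (fun i _ => hqs i) n ht
  have hcombeq : ∀ (v : Fin k → ℂ), ∀ t ∈ J, ∑ m ∈ Finset.range (k + 1),
      h m t * iteratedDeriv m (fun s => ∑ i, v i * q i s) t = 0 := by
    intro v t ht
    simp only [hcomb v _ t ht, Finset.mul_sum]
    rw [Finset.sum_comm]
    refine Finset.sum_eq_zero fun i _ => ?_
    have := congrArg (v i * ·) (hqe i t ht)
    simpa only [Finset.mul_sum, mul_zero, mul_left_comm] using this
  have hsm : ∀ v : Fin k → ℂ, ContDiffOn ℝ ∞ (fun s => ∑ i, v i * q i s) J := fun v =>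
    ContDiffOn.sum fun i _ => contDiffOn_const.mul (hqs i)
  -- A null vector `v` of `Q t` would give a solution with null Cauchy data at `t`, hence the null
  -- solution; but its data at `c` are `v`.
  have hdet : ∀ t ∈ J, (Q t).det ≠ 0 := by
    intro t ht h0
    obtain ⟨v, hv, hv0⟩ := Matrix.exists_mulVec_eq_zero_iff.2 h0
    refine hv (funext fun j => ?_)
    have hz := scalar_eq_zero hJ hc hh hk hk0 ht (hsm v) (fun j hj => ?_) (hcombeq v)
    · have := iteratedDeriv_congr_of_eqOn (g := fun _ => 0) hJ hz j hcJ
      rw [hcomb v j c hcJ] at this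
      simpa [hqc, Pi.single_apply] using this
    · rw [hcomb v j t ht]
      have := congrFun hv0 ⟨j, hj⟩
      simpa [Matrix.mulVec, dotProduct, Q, mul_comm] using this
  -- `b t'` is the vector of Cauchy data prescribed at `t = t'`. Solving `Q(t') p(t') = b(t')` by
  -- Cramer's rule keeps `p` smooth, so `x` is smooth jointly and separable.
  let b : ℝ → Fin k → ℂ := fun t j => if (j : ℕ) + 1 < k then 0 else -(h k t)⁻¹
  let p : Fin k → ℝ → ℂ := fun i t => ((Q t).det)⁻¹ * (Q t).cramer (b t) i
  have hps : ∀ i, ContDiffOn ℝ ∞ (p i) J := by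
    refine fun i => ((contDiffOn_det hQs).inv hdet).mul (contDiffOn_cramer hQs (fun j => ?_) i)
    by_cases hj : (j : ℕ) + 1 < k
    · simp only [b, hj, if_true]; exact contDiffOn_const
    · simp only [b, hj, if_false]; exact ((hh k le_rfl).inv hk).neg
  have hpb : ∀ t ∈ J, ∀ j : Fin k, ∑ i, p i t * iteratedDeriv j (q i) t = b t j := by
    intro t ht j
    have := congrFun (Matrix.mulVec_cramer (Q t) (b t)) j
    simp only [Matrix.mulVec, dotProduct, Pi.smul_apply, smul_eq_mul, Q, Matrix.of_apply] at this
    have h2 := hdet t ht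
    simp only [p, Q] at *
    rw [← inv_mul_cancel_left₀ h2 (b t j), ← this, Finset.mul_sum]
    exact Finset.sum_congr rfl fun i _ => by ring
  refine ⟨p, q, hps, hqs, fun t' ht' => ⟨hsm _, fun t ht => hcombeq _ t ht, fun j hj => ?_, ?_⟩⟩
  · have := hpb t' ht' ⟨j, by omega⟩
    simp only [rightDeriv]
    rw [hcomb _ j t' ht', this]
    simp [b, hj]
  · have := hpb t' ht' ⟨k - 1, by omega⟩
    simp only [rightDeriv]
    rw [hcomb _ (k - 1) t' ht', this]
    have : ¬ (k - 1 + 1 < k) := by omega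
    simp [b, this]

theorem adjointSolution_unique (hJ : IsOpen J) (hc : J.OrdConnected)
    (hh : ∀ m ≤ k, ContDiffOn ℝ ∞ (h m) J) (hk : ∀ t ∈ J, h k t ≠ 0) (hk0 : 0 < k)
    {x x' : ℝ → ℝ → ℂ} (hx : IsAdjointSolution J k h x) (hx' : IsAdjointSolution J k h x') :
    ∀ t' ∈ J, ∀ t ∈ J, x' t' t = x t' t := by
  intro t' ht' t ht
  obtain ⟨h1, h2, h3, h4⟩ := hx t' ht'
  obtain ⟨k1, k2, k3, k4⟩ := hx' t' ht'
  have hsub : ∀ n, ∀ s ∈ J, iteratedDeriv n (x' t' - x t') s =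
      rightDeriv n x' t' s - rightDeriv n x t' s := fun n s hs =>
    iteratedDeriv_sub ((k1.contDiffAt (hJ.mem_nhds hs)).of_le (by exact_mod_cast le_top))
      ((h1.contDiffAt (hJ.mem_nhds hs)).of_le (by exact_mod_cast le_top))
  have := scalar_eq_zero hJ hc hh hk hk0 ht' (x := x' t' - x t') (k1.sub h1) (fun j hj => ?_)
    (fun s hs => ?_) t ht
  · exact sub_eq_zero.1 this
  · rw [hsub j t' ht']
    rcases Nat.lt_or_ge (j + 1) k with hj' | hj'
    · rw [h3 j hj', k3 j hj', sub_zero]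
    · obtain rfl : j = k - 1 := by omega
      rw [h4, k4, sub_self]
  · simp only [hsub _ s hs, mul_sub, Finset.sum_sub_distrib, h2 s hs, k2 s hs, sub_zero]

end Scalar

/-! ### The basic operators on causal functions -/

section Operators

variable {J : Set ℝ}

lemma causalFun_ext {φ ψ : CausalFun J} (h : ∀ t ∈ J, (φ : ℝ → ℂ) t = (ψ : ℝ → ℂ) t) : φ = ψ := by
  refine Subtype.ext (funext fun t => ?_)
  by_cases ht : t ∈ J
  · exact h t ht
  · rw [φ.2.2.1 t ht, ψ.2.2.1 t ht]

/-- Two causal functions vanish on the left of a common point. -/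
lemma exists_forall_lt_eq_zero₂ (φ ψ : CausalFun J) {b : ℝ} (hb : b ∈ J) :
    ∃ c ∈ J, c ≤ b ∧ (∀ t < c, (φ : ℝ → ℂ) t = 0) ∧ ∀ t < c, (ψ : ℝ → ℂ) t = 0 := by
  obtain ⟨c, hc, hcb, hφ⟩ := φ.2.2.2 b hb
  obtain ⟨d, hd, hdc, hψ⟩ := ψ.2.2.2 c hc
  exact ⟨d, hd, hdc.trans hcb, fun t ht => hφ t (ht.trans_le hdc), hψ⟩

lemma heaviside_mul_eq_indicator {ψ : ℝ → ℂ} {c : ℝ} (hψ : ∀ t < c, ψ t = 0) (t : ℝ) :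
    (fun τ => heaviside (t - τ) * ψ τ) = (Icc c t).indicator ψ := by
  funext τ
  by_cases hτ : τ ∈ Icc c t
  · rw [indicator_of_mem hτ, heaviside, if_pos (sub_nonneg.2 hτ.2), one_mul]
  · rw [indicator_of_notMem hτ]
    rcases lt_or_ge τ c with h | h
    · rw [hψ τ h, mul_zero]
    · have : ¬ (0 ≤ t - τ) := fun h' => hτ ⟨h, sub_nonneg.1 h'⟩
      rw [heaviside, if_neg this, zero_mul]

lemma integrableOn_heaviside_mul (hc : J.OrdConnected) (ψ : CausalFun J) {t : ℝ} (ht : t ∈ J) :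
    IntegrableOn (fun τ => heaviside (t - τ) * (ψ : ℝ → ℂ) τ) J := by
  obtain ⟨c, hcJ, -, hψ⟩ := ψ.2.2.2 t ht
  rw [heaviside_mul_eq_indicator hψ]
  refine Integrable.integrableOn ((integrable_indicator_iff measurableSet_Icc).2 ?_)
  exact (ψ.2.1.continuousOn.mono (hc.out hcJ ht)).integrableOn_compact isCompact_Icc

/-- No order between `c` and `t` is needed: for `t < c` both sides vanish. Hence the formula holds
on a full neighbourhood of `t` even when `c = t`, and the primitive can be differentiated there. -/
lemma integral_heaviside_mul (ψ : CausalFun J) {c t : ℝ} (hψ : ∀ t < c, (ψ : ℝ → ℂ) t = 0) :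
    ∫ τ in J, heaviside (t - τ) * (ψ : ℝ → ℂ) τ = ∫ τ in c..t, (ψ : ℝ → ℂ) τ := by
  rw [setIntegral_eq_integral_of_forall_compl_eq_zero
    (fun τ hτ => by rw [ψ.2.2.1 τ hτ, mul_zero]), heaviside_mul_eq_indicator hψ,
    integral_indicator measurableSet_Icc, integral_Icc_eq_integral_Ioc]
  rcases le_total c t with h | h
  · rw [intervalIntegral.integral_of_le h]
  · rw [Ioc_eq_empty (not_lt.2 h), setIntegral_empty, intervalIntegral.integral_symm,
      intervalIntegral.integral_of_le h, ← integral_Ico_eq_integral_Ioc,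
      setIntegral_eq_zero_of_forall_eq_zero (fun τ hτ => hψ τ hτ.2), neg_zero]

open Classical in
/-- Multiplication by `a(t')`, the generalized function `a(t') δ`; null unless `a` is smooth. -/
def mulOp (J : Set ℝ) (a : ℝ → ℂ) : GenFun J :=
  if ha : ContDiffOn ℝ ∞ a J then
    { toFun := fun φ => ⟨fun t => a t * (φ : ℝ → ℂ) t, ha.mul φ.2.1,
        fun t ht => by simp only [φ.2.2.1 t ht, mul_zero], fun b hb => by
          obtain ⟨c, hc, hcb, hφ⟩ := φ.2.2.2 b hb
          exact ⟨c, hc, hcb, fun t ht => by simp only [hφ t ht, mul_zero]⟩⟩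
      map_add' := fun φ ψ => Subtype.ext (funext fun t => mul_add _ _ _)
      map_smul' := fun z φ => Subtype.ext (funext fun t => mul_left_comm _ _ _) }
  else 0

lemma mulOp_apply {a : ℝ → ℂ} (ha : ContDiffOn ℝ ∞ a J) (φ : CausalFun J) (t : ℝ) :
    (mulOp J a φ : ℝ → ℂ) t = a t * (φ : ℝ → ℂ) t := by
  rw [mulOp, dif_pos ha]; rfl

/-- Differentiation, the generalized function `δ'`. -/
def derivOp (hJ : IsOpen J) : GenFun J where
  toFun φ := ⟨J.indicator (deriv φ), (contDiffOn_deriv hJ φ.2.1).congr fun t ht => by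
      rw [indicator_of_mem ht], fun t ht => indicator_of_notMem ht _, fun b hb => by
      obtain ⟨c, hc, hcb, hφ⟩ := φ.2.2.2 b hb
      refine ⟨c, hc, hcb, fun t ht => ?_⟩
      have h0 : (φ : ℝ → ℂ) =ᶠ[𝓝 t] fun _ => 0 :=
        Filter.eventually_of_mem (Iio_mem_nhds ht) fun s hs => hφ s hs
      by_cases htJ : t ∈ J
      · rw [indicator_of_mem htJ, h0.deriv_eq, deriv_const]
      · rw [indicator_of_notMem htJ]⟩
  map_add' φ ψ := causalFun_ext fun t ht => by
    simpa [ht] using ((hasDerivAt_of_contDiffOn hJ φ.2.1 ht).add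
      (hasDerivAt_of_contDiffOn hJ ψ.2.1 ht)).deriv
  map_smul' z φ := causalFun_ext fun t ht => by
    simpa only [RingHom.id_apply, Submodule.coe_smul, Pi.smul_apply, indicator_of_mem ht] using
      ((hasDerivAt_of_contDiffOn hJ φ.2.1 ht).const_smul z).deriv

lemma derivOp_apply (hJ : IsOpen J) (φ : CausalFun J) {t : ℝ} (ht : t ∈ J) :
    (derivOp hJ φ : ℝ → ℂ) t = deriv φ t := indicator_of_mem ht _

lemma hasDerivAt_primitive (hJ : IsOpen J) (hc : J.OrdConnected) (φ : CausalFun J) {t : ℝ}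
    (ht : t ∈ J) :
    HasDerivAt (fun s => ∫ τ in J, heaviside (s - τ) * (φ : ℝ → ℂ) τ) ((φ : ℝ → ℂ) t) t := by
  obtain ⟨c, hcJ, -, hφ⟩ := φ.2.2.2 t ht
  simp only [integral_heaviside_mul φ hφ]
  exact hasDerivAt_integral_of_continuousOn hJ hc φ.2.1.continuousOn hcJ ht

/-- The causal primitive, the generalized function `Θ`. -/
def primOp (hJ : IsOpen J) (hc : J.OrdConnected) : GenFun J where
  toFun φ := ⟨J.indicator fun t => ∫ τ in J, heaviside (t - τ) * (φ : ℝ → ℂ) τ, by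
      refine ContDiffOn.congr (f := fun t => ∫ τ in J, heaviside (t - τ) * (φ : ℝ → ℂ) τ) ?_
        fun t ht => by rw [indicator_of_mem ht]
      rw [contDiffOn_infty_iff_deriv_of_isOpen hJ]
      exact ⟨fun t ht =>
        (hasDerivAt_primitive hJ hc φ ht).differentiableAt.differentiableWithinAt,
        φ.2.1.congr fun t ht => (hasDerivAt_primitive hJ hc φ ht).deriv⟩,
    fun t ht => indicator_of_notMem ht _, fun b hb => by
      obtain ⟨c, hcJ, hcb, hφ⟩ := φ.2.2.2 b hb
      refine ⟨c, hcJ, hcb, fun t ht => ?_⟩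
      by_cases htJ : t ∈ J
      · rw [indicator_of_mem htJ, heaviside_mul_eq_indicator hφ, Icc_eq_empty (not_le.2 ht)]
        simp
      · rw [indicator_of_notMem htJ]⟩
  map_add' φ ψ := causalFun_ext fun t ht => by
    have := integral_add (integrableOn_heaviside_mul hc φ ht) (integrableOn_heaviside_mul hc ψ ht)
    simpa [ht, mul_add] using this
  map_smul' z φ := causalFun_ext fun t ht => by
    simpa [ht, mul_left_comm] using
      integral_const_mul z (fun τ => heaviside (t - τ) * (φ : ℝ → ℂ) τ) (μ := volume.restrict J)

lemma primOp_apply (hJ : IsOpen J) (hc : J.OrdConnected) (φ : CausalFun J) {t : ℝ} (ht : t ∈ J) :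
    (primOp hJ hc φ : ℝ → ℂ) t = ∫ τ in J, heaviside (t - τ) * (φ : ℝ → ℂ) τ :=
  indicator_of_mem ht (fun t => ∫ τ in J, heaviside (t - τ) * (φ : ℝ → ℂ) τ)

lemma genFun_ext {S T : GenFun J} (h : ∀ φ, ∀ t ∈ J, (S φ : ℝ → ℂ) t = (T φ : ℝ → ℂ) t) : S = T :=
  LinearMap.ext fun φ => causalFun_ext (h φ)

lemma derivOp_mul_primOp (hJ : IsOpen J) (hc : J.OrdConnected) :
    derivOp hJ * primOp hJ hc = 1 := genFun_ext fun φ t ht => by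
  rw [Module.End.mul_apply, derivOp_apply hJ _ ht, Module.End.one_apply,
    ← (hasDerivAt_primitive hJ hc φ ht).deriv]
  refine Filter.EventuallyEq.deriv_eq (Filter.eventually_of_mem (hJ.mem_nhds ht) fun s hs => ?_)
  exact primOp_apply hJ hc φ hs

/-- This is where causality matters: the constant of integration `φ c` is `0`, by continuity,
because `φ` vanishes on the left of `c`. -/
lemma primOp_mul_derivOp (hJ : IsOpen J) (hc : J.OrdConnected) :
    primOp hJ hc * derivOp hJ = 1 := genFun_ext fun φ t ht => by
  obtain ⟨c, hcJ, -, hφ, hφ'⟩ := exists_forall_lt_eq_zero₂ φ (derivOp hJ φ) ht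
  rw [Module.End.mul_apply, primOp_apply hJ hc _ ht, Module.End.one_apply,
    integral_heaviside_mul _ hφ',
    intervalIntegral.integral_congr_ae (g := deriv φ) (Filter.Eventually.of_forall fun τ hτ =>
      derivOp_apply hJ φ (hc.uIcc_subset hcJ ht (uIoc_subset_uIcc hτ))),
    intervalIntegral.integral_eq_sub_of_hasDerivAt
      (fun τ hτ => hasDerivAt_of_contDiffOn hJ φ.2.1 (hc.uIcc_subset hcJ ht hτ))
      (((contDiffOn_deriv hJ φ.2.1).continuousOn.mono
        (hc.uIcc_subset hcJ ht)).intervalIntegrable)]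
  have h0 : (φ : ℝ → ℂ) c = 0 := by
    have hcont : Filter.Tendsto (φ : ℝ → ℂ) (𝓝[<] c) (𝓝 ((φ : ℝ → ℂ) c)) :=
      ((φ.2.1.continuousOn.continuousAt (hJ.mem_nhds hcJ)).tendsto).mono_left nhdsWithin_le_nhds
    have h0 : Filter.Tendsto (φ : ℝ → ℂ) (𝓝[<] c) (𝓝 0) :=
      tendsto_const_nhds.congr' (Filter.eventually_of_mem self_mem_nhdsWithin
        fun s hs => (hφ s hs).symm)
    exact tendsto_nhds_unique hcont h0
  rw [h0, sub_zero]

lemma derivOp_mul_mulOp (hJ : IsOpen J) {a : ℝ → ℂ} (ha : ContDiffOn ℝ ∞ a J) :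
    derivOp hJ * mulOp J a = mulOp J a * derivOp hJ + mulOp J (deriv a) :=
  genFun_ext fun φ t ht => by
  have h1 : (mulOp J a φ : ℝ → ℂ) = fun t => a t * (φ : ℝ → ℂ) t :=
    funext fun t => mulOp_apply ha φ t
  simp only [Module.End.mul_apply, LinearMap.add_apply, Submodule.coe_add, Pi.add_apply,
    mulOp_apply ha, mulOp_apply (contDiffOn_deriv hJ ha), derivOp_apply hJ _ ht, h1]
  rw [((hasDerivAt_of_contDiffOn hJ ha ht).fun_mul (hasDerivAt_of_contDiffOn hJ φ.2.1 ht)).deriv,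
    add_comm]

lemma derivOp_pow_apply (hJ : IsOpen J) (n : ℕ) (φ : CausalFun J) {t : ℝ} (ht : t ∈ J) :
    ((derivOp hJ ^ n) φ : ℝ → ℂ) t = iteratedDeriv n φ t := by
  induction n generalizing t with
  | zero => simp
  | succ n ih =>
    rw [pow_succ', Module.End.mul_apply, derivOp_apply hJ _ ht, iteratedDeriv_succ]
    exact Filter.EventuallyEq.deriv_eq
      (Filter.eventually_of_mem (hJ.mem_nhds ht) fun s hs => ih hs)

lemma mulOp_congr {a b : ℝ → ℂ} (h : EqOn a b J) : mulOp J a = mulOp J b := by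
  by_cases ha : ContDiffOn ℝ ∞ a J
  · have hb : ContDiffOn ℝ ∞ b J := ha.congr fun t ht => (h ht).symm
    exact genFun_ext fun φ t ht => by rw [mulOp_apply ha, mulOp_apply hb, h ht]
  · have hb : ¬ ContDiffOn ℝ ∞ b J := fun hb => ha (hb.congr h)
    rw [mulOp, dif_neg ha, mulOp, dif_neg hb]

lemma mulOp_mul_mulOp {a b : ℝ → ℂ} (ha : ContDiffOn ℝ ∞ a J) (hb : ContDiffOn ℝ ∞ b J) :
    mulOp J a * mulOp J b = mulOp J (fun t => a t * b t) :=
  genFun_ext fun φ t _ => by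
    rw [Module.End.mul_apply, mulOp_apply ha, mulOp_apply hb, mulOp_apply (ha.mul hb), mul_assoc]

lemma genFun_sum_apply {ι : Type*} (s : Finset ι) (T : ι → GenFun J) (φ : CausalFun J) (t : ℝ) :
    ((∑ i ∈ s, T i) φ : ℝ → ℂ) t = ∑ i ∈ s, (T i φ : ℝ → ℂ) t := by
  rw [LinearMap.sum_apply, Submodule.coe_sum, Finset.sum_apply]

lemma sum_mulOp {ι : Type*} (s : Finset ι) {a : ι → ℝ → ℂ}
    (ha : ∀ i ∈ s, ContDiffOn ℝ ∞ (a i) J) :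
    ∑ i ∈ s, mulOp J (a i) = mulOp J (fun t => ∑ i ∈ s, a i t) :=
  genFun_ext fun φ t _ => by
    rw [genFun_sum_apply, mulOp_apply (ContDiffOn.sum ha), Finset.sum_mul]
    exact Finset.sum_congr rfl fun i hi => mulOp_apply (ha i hi) φ t

lemma mulOp_one {a : ℝ → ℂ} (h : ∀ t ∈ J, a t = 1) : mulOp J a = 1 :=
  genFun_ext fun φ t ht => by
    rw [mulOp_apply (contDiffOn_const.congr h), h t ht, one_mul, Module.End.one_apply]

/-- Integration by parts, once. -/
lemma primOp_mul_mulOp_mul_derivOp (hJ : IsOpen J) (hc : J.OrdConnected) {y : ℝ → ℂ}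
    (hy : ContDiffOn ℝ ∞ y J) :
    primOp hJ hc * mulOp J y * derivOp hJ =
      mulOp J y + (-1 : ℂ) • (primOp hJ hc * mulOp J (deriv y)) := by
  have h := congrArg (primOp hJ hc * ·) (derivOp_mul_mulOp hJ hy)
  simp only [← mul_assoc, primOp_mul_derivOp, one_mul, mul_add] at h
  conv_rhs => rw [h]
  module

/-- Integration by parts, repeated. -/
lemma primOp_mul_mulOp_mul_derivOp_pow (hJ : IsOpen J) (hc : J.OrdConnected) {y : ℝ → ℂ}
    (hy : ContDiffOn ℝ ∞ y J) (n : ℕ) :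
    primOp hJ hc * mulOp J y * derivOp hJ ^ n =
      (-1 : ℂ) ^ n • (primOp hJ hc * mulOp J (iteratedDeriv n y)) +
      ∑ i ∈ Finset.range n, (-1 : ℂ) ^ i •
        (mulOp J (iteratedDeriv i y) * derivOp hJ ^ (n - 1 - i)) := by
  induction n with
  | zero => simp
  | succ n ih =>
    rw [pow_succ, ← mul_assoc, ih, add_mul, smul_mul_assoc,
      primOp_mul_mulOp_mul_derivOp hJ hc (contDiffOn_iteratedDeriv hJ hy n), ← iteratedDeriv_succ,
      Finset.sum_range_succ, Finset.sum_mul]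
    have : ∀ i ∈ Finset.range n, ((-1 : ℂ) ^ i •
        (mulOp J (iteratedDeriv i y) * derivOp hJ ^ (n - 1 - i))) * derivOp hJ =
        (-1 : ℂ) ^ i • (mulOp J (iteratedDeriv i y) * derivOp hJ ^ (n + 1 - 1 - i)) := by
      intro i hi
      have hi := Finset.mem_range.1 hi
      rw [smul_mul_assoc, mul_assoc, ← pow_succ, show n - 1 - i + 1 = n + 1 - 1 - i by omega]
    rw [Finset.sum_congr rfl this]
    simp only [Nat.add_sub_cancel, Nat.sub_self, pow_zero, mul_one, pow_succ]
    module

/-! ### Separable kernels in terms of the basic operators -/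

/-- The generalized function `∑ i, a_i(t') b_i(t) Θ(t'-t)`. -/
def sepOp (hJ : IsOpen J) (hc : J.OrdConnected) {ι : Type*} [Fintype ι] (a b : ι → ℝ → ℂ) :
    GenFun J := ∑ i, mulOp J (a i) * primOp hJ hc * mulOp J (b i)

lemma sepOp_apply (hJ : IsOpen J) (hc : J.OrdConnected) {ι : Type*} [Fintype ι]
    {a b : ι → ℝ → ℂ} (ha : ∀ i, ContDiffOn ℝ ∞ (a i) J) (hb : ∀ i, ContDiffOn ℝ ∞ (b i) J)
    {F : ℝ → ℝ → ℂ} (hF : ∀ t' ∈ J, ∀ t ∈ J, F t' t = ∑ i, a i t' * b i t)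
    (φ : CausalFun J) {t' : ℝ} (ht' : t' ∈ J) :
    (sepOp hJ hc a b φ : ℝ → ℂ) t' =
      ∫ τ in J, F t' τ * heaviside (t' - τ) * (φ : ℝ → ℂ) τ := by
  have h1 : ∀ i, (mulOp J (a i) (primOp hJ hc (mulOp J (b i) φ)) : ℝ → ℂ) t' =
      ∫ τ in J, a i t' * (heaviside (t' - τ) * (mulOp J (b i) φ : ℝ → ℂ) τ) := fun i => by
    rw [mulOp_apply (ha i), primOp_apply hJ hc _ ht', integral_const_mul]
  rw [sepOp, genFun_sum_apply]
  simp only [Module.End.mul_apply, h1]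
  rw [← integral_finsetSum _ fun i _ =>
    (integrableOn_heaviside_mul hc (mulOp J (b i) φ) ht').const_mul (a i t')]
  refine setIntegral_congr_fun hJ.measurableSet fun τ hτ => ?_
  simp only [hF t' ht' τ hτ, mulOp_apply (hb _), Finset.sum_mul]
  exact Finset.sum_congr rfl fun i _ => by ring

lemma sepOp_represents (hJ : IsOpen J) (hc : J.OrdConnected) {ι : Type*} [Fintype ι]
    {a b : ι → ℝ → ℂ} (ha : ∀ i, ContDiffOn ℝ ∞ (a i) J) (hb : ∀ i, ContDiffOn ℝ ∞ (b i) J)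
    {F : ℝ → ℝ → ℂ} (hF : ∀ t' ∈ J, ∀ t ∈ J, F t' t = ∑ i, a i t' * b i t) :
    (thetaKernel F).Represents (sepOp hJ hc a b) := fun φ t' ht' => by
  rw [sepOp_apply hJ hc ha hb hF φ ht']
  simp [thetaKernel]

/-- Leibniz' rule in each term, with `D P = 1`: the jump of the kernel across the diagonal becomes a
multiplication operator. -/
lemma derivOp_mul_sepOp (hJ : IsOpen J) (hc : J.OrdConnected) {ι : Type*} [Fintype ι]
    {a b : ι → ℝ → ℂ} (ha : ∀ i, ContDiffOn ℝ ∞ (a i) J) (hb : ∀ i, ContDiffOn ℝ ∞ (b i) J) :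
    derivOp hJ * sepOp hJ hc a b =
      mulOp J (fun t => ∑ i, a i t * b i t) + sepOp hJ hc (fun i => deriv (a i)) b := by
  rw [sepOp, sepOp, ← sum_mulOp _ fun i _ => (ha i).mul (hb i), Finset.mul_sum,
    ← Finset.sum_add_distrib]
  refine Finset.sum_congr rfl fun i _ => ?_
  rw [← mul_assoc, ← mul_assoc, derivOp_mul_mulOp hJ (ha i), add_mul, add_mul,
    mul_assoc (mulOp J (a i)), derivOp_mul_primOp, mul_one, mulOp_mul_mulOp (ha i) (hb i)]

/-- Derivatives of `∑ i, a_i(t') b_i(t) Θ(t'-t)` in `t'`. -/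
lemma derivOp_pow_mul_sepOp (hJ : IsOpen J) (hc : J.OrdConnected) {ι : Type*} [Fintype ι]
    {a b : ι → ℝ → ℂ} (ha : ∀ i, ContDiffOn ℝ ∞ (a i) J) (hb : ∀ i, ContDiffOn ℝ ∞ (b i) J)
    (n : ℕ) :
    derivOp hJ ^ n * sepOp hJ hc a b = sepOp hJ hc (fun i => iteratedDeriv n (a i)) b +
      ∑ l ∈ Finset.range n, derivOp hJ ^ l *
        mulOp J (fun t => ∑ i, iteratedDeriv (n - l - 1) (a i) t * b i t) := by
  induction n with
  | zero => simp
  | succ n ih =>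
    rw [pow_succ', mul_assoc, ih, mul_add,
      derivOp_mul_sepOp hJ hc (fun i => contDiffOn_iteratedDeriv hJ (ha i) n) hb,
      Finset.sum_range_succ', Finset.mul_sum]
    simp only [← iteratedDeriv_succ, ← mul_assoc, ← pow_succ', Nat.add_sub_add_right, pow_zero,
      one_mul, Nat.sub_zero, Nat.add_sub_cancel]
    abel

end Operators

/-! ### Separable kernels with non-vanishing diagonal act surjectively -/

section Surjective

variable {J : Set ℝ} {ι : Type*} [Fintype ι]

/-- Linear systems with a causal right-hand side have causal solutions. -/
theorem exists_causal_system_solution (hJ : IsOpen J) (hc : J.OrdConnected) {A : ι → ι → ℝ → ℂ}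
    (hA : ∀ i j, ContDiffOn ℝ ∞ (A i j) J) {β : ι → ℝ → ℂ} (hβ : ∀ i, ContDiffOn ℝ ∞ (β i) J)
    (ρ : CausalFun J) :
    ∃ U : ι → CausalFun J, ∀ i, ∀ t ∈ J, (derivOp hJ (U i) : ℝ → ℂ) t =
      ∑ j, A i j t * (U j : ℝ → ℂ) t + β i t * (ρ : ℝ → ℂ) t := by
  rcases J.eq_empty_or_nonempty with rfl | ⟨b, hb⟩
  · exact ⟨0, fun i t ht => absurd ht (notMem_empty t)⟩
  obtain ⟨c, hcJ, -, hρ⟩ := ρ.2.2.2 b hb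
  obtain ⟨p, q, hpq, -, hpqJ⟩ := exists_Ioo_subset hJ hc hcJ hcJ
  obtain ⟨d, hpd, hdc⟩ := exists_between hpq.1
  have hdJ : d ∈ J := hpqJ ⟨hpd.le, (hdc.trans hpq.2).le⟩
  -- The null Cauchy data are put at `d`, strictly to the left of `c`. On `J ∩ Iio c` the system is
  -- homogeneous, so the solution is null there and therefore causal.
  obtain ⟨y, hyd, hys, hy⟩ := exists_system_solution hJ hc hA (r := fun i t => β i t *
    (ρ : ℝ → ℂ) t) (fun i => (hβ i).mul ρ.2.1) hdJ 0
  have hzero : ∀ i, ∀ t ∈ J ∩ Iio c, y i t = 0 := by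
    refine system_eq_zero (hJ.inter isOpen_Iio) (hc.inter ordConnected_Iio)
      (fun i j => (hA i j).continuousOn.mono inter_subset_left) ⟨hdJ, hdc⟩ (fun i t ht => ?_) hyd
    have := hy i t ht.1
    rwa [hρ t ht.2, mul_zero, add_zero] at this
  refine ⟨fun i => ⟨J.indicator (y i), (hys i).congr fun t ht => by rw [indicator_of_mem ht],
    fun t ht => indicator_of_notMem ht _, fun b' hb' => ⟨min b' d, ?_, min_le_left _ _,
      fun t ht => ?_⟩⟩, fun i t ht => ?_⟩
  · rcases min_choice b' d with h | h <;> rw [h] <;> assumption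
  · by_cases htJ : t ∈ J
    · rw [indicator_of_mem htJ]
      exact hzero i t ⟨htJ, (ht.trans_le (min_le_right _ _)).trans hdc⟩
    · rw [indicator_of_notMem htJ]
  · rw [derivOp_apply hJ _ ht]
    have : J.indicator (y i) =ᶠ[𝓝 t] y i :=
      Filter.eventually_of_mem (hJ.mem_nhds ht) fun s hs => indicator_of_mem hs _
    rw [this.deriv_eq, (hy i t ht).deriv]
    simp [ht]

/-- With `f = ∑ a_i b_i` and `U_i = P (b_i φ)`, the derivative of the equation for `φ` reads `f φ +
∑ a_i' U_i = ψ'`. Eliminating `φ` gives the linear system `U_i' = b_i f⁻¹ (ψ' - ∑ a_j' U_j)`; its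
causal solution determines `φ`, and `D` is injective. -/
theorem sepOp_surjective (hJ : IsOpen J) (hc : J.OrdConnected) {a b : ι → ℝ → ℂ}
    (ha : ∀ i, ContDiffOn ℝ ∞ (a i) J) (hb : ∀ i, ContDiffOn ℝ ∞ (b i) J)
    (hne : ∀ t ∈ J, ∑ i, a i t * b i t ≠ 0) : Function.Surjective (sepOp hJ hc a b) := by
  intro ψ
  have hf : ContDiffOn ℝ ∞ (fun t => ∑ i, a i t * b i t) J :=
    ContDiffOn.sum fun i _ => (ha i).mul (hb i)
  have hfi : ContDiffOn ℝ ∞ (fun t => (∑ i, a i t * b i t)⁻¹) J := hf.inv hne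
  have ha' : ∀ i, ContDiffOn ℝ ∞ (deriv (a i)) J := fun i => contDiffOn_deriv hJ (ha i)
  obtain ⟨U, hU⟩ := exists_causal_system_solution hJ hc
    (A := fun i j t => -(b i t * (∑ i, a i t * b i t)⁻¹ * deriv (a j) t))
    (fun i j => (((hb i).mul hfi).mul (ha' j)).neg)
    (β := fun i t => b i t * (∑ i, a i t * b i t)⁻¹) (fun i => (hb i).mul hfi) (derivOp hJ ψ)
  set φ : CausalFun J := mulOp J (fun t => (∑ i, a i t * b i t)⁻¹)
    (derivOp hJ ψ - ∑ j, mulOp J (deriv (a j)) (U j)) with hφ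
  have hφt : ∀ t, (φ : ℝ → ℂ) t = (∑ i, a i t * b i t)⁻¹ *
      ((derivOp hJ ψ : ℝ → ℂ) t - ∑ j, deriv (a j) t * (U j : ℝ → ℂ) t) := fun t => by
    rw [hφ, mulOp_apply hfi, Submodule.coe_sub, Pi.sub_apply, Submodule.coe_sum, Finset.sum_apply]
    simp only [mulOp_apply (ha' _)]
  have hUφ : ∀ i, primOp hJ hc (mulOp J (b i) φ) = U i := by
    intro i
    have h1 : mulOp J (b i) φ = derivOp hJ (U i) := causalFun_ext fun t ht => by
      rw [mulOp_apply (hb i), hU i t ht, hφt]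
      simp only [neg_mul, Finset.sum_neg_distrib, mul_assoc, ← Finset.mul_sum]
      ring
    rw [h1, ← Module.End.mul_apply, primOp_mul_derivOp, Module.End.one_apply]
  have hD : derivOp hJ (sepOp hJ hc a b φ) = derivOp hJ ψ := by
    rw [← Module.End.mul_apply, derivOp_mul_sepOp hJ hc ha hb]
    refine causalFun_ext fun t ht => ?_
    rw [LinearMap.add_apply, Submodule.coe_add, Pi.add_apply, mulOp_apply hf, sepOp,
      genFun_sum_apply, hφt, mul_inv_cancel_left₀ (hne t ht)]
    simp only [Module.End.mul_apply, hUφ, mulOp_apply (ha' _), sub_add_cancel]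
  refine ⟨φ, ?_⟩
  have := congrArg (primOp hJ hc) hD
  simpa only [← Module.End.mul_apply, ← mul_assoc, primOp_mul_derivOp, one_mul,
    Module.End.one_apply] using this

end Surjective

/-! ### Separable functions -/

section Separable

variable {F : ℝ → ℝ → ℂ} {I : Set ℝ}

/-- A separable function has finitely many linearly independent columns that span all of them. -/
theorem IsSeparableOn.exists_columns (hsep : IsSeparableOn F I) :
    ∃ (n : ℕ) (s : Fin n → ℝ) (α : Fin n → ℝ → ℂ), (∀ i, s i ∈ I) ∧
      LinearIndependent ℂ (fun i => I.domRestrict fun t' => F t' (s i)) ∧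
      ∀ t' ∈ I, ∀ t ∈ I, F t' t = ∑ i, α i t * F t' (s i) := by
  obtain ⟨n, a, b, hab⟩ := hsep
  let v : I → (I → ℂ) := fun t => I.domRestrict fun t' => F t' t
  -- An independent subfamily of the columns with the same span; it is finite because every column
  -- lies in the span of the finitely many `a i`.
  obtain ⟨κ, e, -, hspan, hli⟩ := exists_linearIndependent' ℂ v
  have hfin : Finite κ := by
    refine hli.finite_of_le_span_finite _ (range fun i => I.domRestrict (a i)) ?_
    rintro _ ⟨j, rfl⟩
    rw [SetLike.mem_coe, Submodule.mem_span_range_iff_exists_fun]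
    refine ⟨fun i => b i (e j), funext fun t' => ?_⟩
    simp [v, hab t' t'.2 (e j) (e j).2, mul_comm]
  have := Fintype.ofFinite κ
  let σ := Fintype.equivFin κ
  have hmem : ∀ t : I, ∃ c : κ → ℂ, ∑ i, c i • (v ∘ e) i = v t := fun t => by
    rw [← Submodule.mem_span_range_iff_exists_fun, hspan]
    exact Submodule.subset_span ⟨t, rfl⟩
  choose c hcv using hmem
  classical
  refine ⟨Fintype.card κ, fun i => e (σ.symm i),
    fun i t => if ht : t ∈ I then c ⟨t, ht⟩ (σ.symm i) else 0, fun i => (e _).2,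
    hli.comp _ σ.symm.injective, fun t' ht' t ht => ?_⟩
  have h1 := congrFun (hcv ⟨t, ht⟩) ⟨t', ht'⟩
  simp only [Finset.sum_apply, Pi.smul_apply, smul_eq_mul, Function.comp_apply] at h1
  simp only [dif_pos ht]
  rw [Equiv.sum_comp σ.symm (fun i => c ⟨t, ht⟩ i * F t' (e i))]
  exact h1.symm

/-- A smooth separable function is separable with smooth factors. -/
theorem IsSeparableOn.exists_smooth_factors (hsep : IsSeparableOn F I)
    (hF : ContDiffOn ℝ ∞ (Function.uncurry F) (I ×ˢ I)) :
    ∃ (n : ℕ) (a b : Fin n → ℝ → ℂ), (∀ i, ContDiffOn ℝ ∞ (a i) I) ∧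
      (∀ i, ContDiffOn ℝ ∞ (b i) I) ∧ ∀ t' ∈ I, ∀ t ∈ I, F t' t = ∑ i, a i t' * b i t := by
  obtain ⟨n, s, α, hs, -, hα⟩ := hsep.exists_columns
  have hsep' : IsSeparableOn (fun t t' => F t' t) I := by
    obtain ⟨n, a, b, hab⟩ := hsep
    exact ⟨n, b, a, fun t ht t' ht' => by simp only [hab t' ht' t ht, mul_comm]⟩
  obtain ⟨m, r, β, hr, hli, hβ⟩ := hsep'.exists_columns
  have hcol : ∀ x ∈ I, ContDiffOn ℝ ∞ (fun t' => F t' x) I := fun x hx =>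
    hF.comp (contDiffOn_id.prodMk contDiffOn_const) fun t ht => ⟨ht, hx⟩
  have hrow : ∀ x ∈ I, ContDiffOn ℝ ∞ (fun t => F x t) I := fun x hx =>
    hF.comp (contDiffOn_const.prodMk contDiffOn_id) fun t ht => ⟨hx, ht⟩
  -- The rows `F (r i)` are smooth right factors, but nothing is known yet of their coefficients `β
  -- i`. A combination of rows that vanishes at all the `s j` vanishes on `I`, so `C` acts
  -- injectively on row vectors. A left inverse then writes each `β i t'` as a fixed combination of
  -- the smooth columns `F t' (s j)`.
  let C : Matrix (Fin m) (Fin n) ℂ := Matrix.of fun i j => F (r i) (s j)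
  have hinj : LinearMap.ker (Matrix.vecMulLinear C) = ⊥ := by
    rw [LinearMap.ker_eq_bot']
    intro v hv
    refine funext (Fintype.linearIndependent_iff.1 hli v (funext fun t => ?_))
    have h1 : ∀ j, ∑ i, v i * F (r i) (s j) = 0 := fun j => by
      simpa [Matrix.vecMul, dotProduct, C] using congrFun hv j
    simp only [Finset.sum_apply, Pi.smul_apply, smul_eq_mul, domRestrict_apply, Pi.zero_apply]
    calc ∑ i, v i * F (r i) t = ∑ j, α j t * ∑ i, v i * F (r i) (s j) := by
          simp only [hα (r _) (hr _) t t.2, Finset.mul_sum]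
          rw [Finset.sum_comm]
          exact Finset.sum_congr rfl fun _ _ => Finset.sum_congr rfl fun _ _ => by ring
      _ = 0 := by simp [h1]
  obtain ⟨R, hR⟩ := LinearMap.exists_leftInverse_of_injective _ hinj
  refine ⟨m, fun i t' => ∑ j, F t' (s j) * R (Pi.single j 1) i, fun i => F (r i),
    fun i => ContDiffOn.sum fun j _ => (hcol _ (hs j)).mul contDiffOn_const,
    fun i => hrow _ (hr i), fun t' ht' t ht => ?_⟩
  rw [hβ t ht t' ht']
  refine Finset.sum_congr rfl fun i _ => ?_
  congr 1
  have h1 : Matrix.vecMulLinear C (fun i => β i t') = fun j => F t' (s j) := funext fun j => by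
    simp [Matrix.vecMul, dotProduct, C, hβ (s j) (hs j) t' ht']
  have h2 : R (fun j => F t' (s j)) = fun i => β i t' := by
    rw [← h1]; exact LinearMap.congr_fun hR _
  rw [← congrFun h2 i, pi_eq_sum_univ' (fun j => F t' (s j)), map_sum, Finset.sum_apply]
  refine Finset.sum_congr rfl fun j _ => ?_
  rw [map_smul, Pi.smul_apply, smul_eq_mul]

end Separable

/-! ### The inverse computed from an annihilating operator -/

section GivenBy

variable {J : Set ℝ} {ι : Type*} [Fintype ι]

/-- The generalized function `∑_{j < n} g_j(t') δ^{(j)}`. -/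
def diffOp (hJ : IsOpen J) (n : ℕ) (g : ℕ → ℝ → ℂ) : GenFun J :=
  ∑ j ∈ Finset.range n, mulOp J (g j) * derivOp hJ ^ j

lemma diffOp_apply (hJ : IsOpen J) {n : ℕ} {g : ℕ → ℝ → ℂ}
    (hg : ∀ j < n, ContDiffOn ℝ ∞ (g j) J) (φ : CausalFun J) {t : ℝ} (ht : t ∈ J) :
    (diffOp hJ n g φ : ℝ → ℂ) t =
      ∑ j ∈ Finset.range n, g j t * iteratedDeriv j (φ : ℝ → ℂ) t := by
  rw [diffOp, genFun_sum_apply]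
  refine Finset.sum_congr rfl fun j hj => ?_
  rw [Module.End.mul_apply, mulOp_apply (hg j (Finset.mem_range.1 hj)), derivOp_pow_apply hJ _ _ ht]

/-- The action of a regular kernel, as a causal primitive for each `t'`. -/
lemma integral_mul_heaviside_mul (hJ : IsOpen J) (hc : J.OrdConnected) {r : ℝ → ℂ}
    (hr : ContDiffOn ℝ ∞ r J) (φ : CausalFun J) {t' : ℝ} (ht' : t' ∈ J) :
    ∫ τ in J, r τ * heaviside (t' - τ) * (φ : ℝ → ℂ) τ =
      (primOp hJ hc (mulOp J r φ) : ℝ → ℂ) t' := by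
  rw [primOp_apply hJ hc _ ht']
  simp only [mulOp_apply hr]
  congr 1 with τ
  ring

/-! ### Products of separable kernels with differential operators -/

section SepDeriv

variable {a b : ι → ℝ → ℂ} {F : ℝ → ℝ → ℂ}

lemma leftDeriv_sep (hJ : IsOpen J) (ha : ∀ i, ContDiffOn ℝ ∞ (a i) J)
    (hF : ∀ t' ∈ J, ∀ t ∈ J, F t' t = ∑ i, a i t' * b i t) (n : ℕ) {t' t : ℝ} (ht' : t' ∈ J)
    (ht : t ∈ J) : leftDeriv n F t' t = ∑ i, iteratedDeriv n (a i) t' * b i t := by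
  rw [leftDeriv, iteratedDeriv_congr_of_eqOn (g := fun s => ∑ i, b i t * a i s) hJ
    (fun s hs => by simp only [hF s hs t ht, mul_comm]) n ht',
    iteratedDeriv_const_mul_sum _ _ hJ (fun i _ => ha i) n ht']
  simp only [mul_comm]

lemma rightDeriv_sep (hJ : IsOpen J) (hb : ∀ i, ContDiffOn ℝ ∞ (b i) J)
    (hF : ∀ t' ∈ J, ∀ t ∈ J, F t' t = ∑ i, a i t' * b i t) (n : ℕ) {t' t : ℝ} (ht' : t' ∈ J)
    (ht : t ∈ J) : rightDeriv n F t' t = ∑ i, a i t' * iteratedDeriv n (b i) t := by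
  rw [rightDeriv, iteratedDeriv_congr_of_eqOn (g := fun s => ∑ i, a i t' * b i s) hJ
    (fun s hs => hF t' ht' s hs) n ht,
    iteratedDeriv_const_mul_sum _ _ hJ (fun i _ => hb i) n ht]

lemma contDiffOn_leftDeriv_diag (hJ : IsOpen J) (ha : ∀ i, ContDiffOn ℝ ∞ (a i) J)
    (hb : ∀ i, ContDiffOn ℝ ∞ (b i) J)
    (hF : ∀ t' ∈ J, ∀ t ∈ J, F t' t = ∑ i, a i t' * b i t) (n : ℕ) :
    ContDiffOn ℝ ∞ (fun t => leftDeriv n F t t) J :=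
  ContDiffOn.congr (ContDiffOn.sum fun i _ => (contDiffOn_iteratedDeriv hJ (ha i) n).mul (hb i))
    fun _ ht => leftDeriv_sep hJ ha hF n ht ht

/-- If `L` annihilates `F`, then `L ∗ (F Θ)` has no regular part. -/
lemma diffOp_mul_sepOp (hJ : IsOpen J) (hc : J.OrdConnected) (ha : ∀ i, ContDiffOn ℝ ∞ (a i) J)
    (hb : ∀ i, ContDiffOn ℝ ∞ (b i) J)
    (hF : ∀ t' ∈ J, ∀ t ∈ J, F t' t = ∑ i, a i t' * b i t) {k : ℕ} {g : ℕ → ℝ → ℂ}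
    (hg : IsAnnihilator J F k g) :
    diffOp hJ (k + 2) g * sepOp hJ hc a b =
      ∑ j ∈ Finset.range (k + 2), ∑ l ∈ Finset.range j,
        mulOp J (g j) * derivOp hJ ^ l * mulOp J (fun t => leftDeriv (j - l - 1) F t t) := by
  obtain ⟨hgs, hg0⟩ := hg
  have hgs' : ∀ j ∈ Finset.range (k + 2), ContDiffOn ℝ ∞ (g j) J := fun j hj =>
    hgs j (by have := Finset.mem_range.1 hj; omega)
  have hzero : ∑ j ∈ Finset.range (k + 2),
      mulOp J (g j) * sepOp hJ hc (fun i => iteratedDeriv j (a i)) b = 0 := by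
    have : ∀ j ∈ Finset.range (k + 2),
        mulOp J (g j) * sepOp hJ hc (fun i => iteratedDeriv j (a i)) b =
        sepOp hJ hc (fun i t => g j t * iteratedDeriv j (a i) t) b := fun j hj => by
      rw [sepOp, sepOp, Finset.mul_sum]
      refine Finset.sum_congr rfl fun i _ => ?_
      rw [← mul_assoc, ← mul_assoc,
        mulOp_mul_mulOp (hgs' j hj) (contDiffOn_iteratedDeriv hJ (ha i) j)]
    rw [Finset.sum_congr rfl this]
    simp only [sepOp]
    rw [Finset.sum_comm]
    simp only [← Finset.sum_mul]
    have h2 : ∀ i, ∑ j ∈ Finset.range (k + 2), mulOp J (fun t => g j t * iteratedDeriv j (a i) t) =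
        mulOp J (fun t => ∑ j ∈ Finset.range (k + 2), g j t * iteratedDeriv j (a i) t) := fun i =>
      sum_mulOp _ fun j hj => (hgs' j hj).mul (contDiffOn_iteratedDeriv hJ (ha i) j)
    simp only [h2]
    refine genFun_ext fun φ t' ht' => ?_
    -- The action depends on the factors only through the kernel they sum to, which here is `L`
    -- applied to `F`, that is `0`.
    have := sepOp_apply hJ hc
      (a := fun i t => ∑ j ∈ Finset.range (k + 2), g j t * iteratedDeriv j (a i) t)
      (fun i => ContDiffOn.sum fun j hj =>
        (hgs' j hj).mul (contDiffOn_iteratedDeriv hJ (ha i) j)) hb (F := fun _ _ => 0)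
      (fun t' ht' t ht => ?_) φ ht'
    · simpa [sepOp] using this
    · rw [← hg0 t' ht' t ht]
      simp only [leftDeriv_sep hJ ha hF _ ht' ht, Finset.mul_sum, Finset.sum_mul]
      rw [Finset.sum_comm]
      simp only [mul_assoc]
  rw [diffOp, Finset.sum_mul]
  calc _ = ∑ j ∈ Finset.range (k + 2),
        (mulOp J (g j) * sepOp hJ hc (fun i => iteratedDeriv j (a i)) b +
        ∑ l ∈ Finset.range j, mulOp J (g j) * derivOp hJ ^ l *
          mulOp J (fun t => leftDeriv (j - l - 1) F t t)) := by
        refine Finset.sum_congr rfl fun j _ => ?_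
        rw [mul_assoc, derivOp_pow_mul_sepOp hJ hc ha hb, mul_add, Finset.mul_sum]
        congr 1
        refine Finset.sum_congr rfl fun l _ => ?_
        rw [mul_assoc, mulOp_congr (a := fun t => leftDeriv (j - l - 1) F t t)
          fun t ht => leftDeriv_sep hJ ha hF _ ht ht]
    _ = _ := by rw [Finset.sum_add_distrib, hzero, zero_add]

/-- Integration by parts in `(x Θ) ∗ (y δ^{(n)})`, with `x` separable. -/
lemma sepOp_mul_derivOp_pow_apply (hJ : IsOpen J) (hc : J.OrdConnected) {p q : ι → ℝ → ℂ}
    (hp : ∀ i, ContDiffOn ℝ ∞ (p i) J) (hq : ∀ i, ContDiffOn ℝ ∞ (q i) J) {x : ℝ → ℝ → ℂ}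
    (hx : ∀ t' ∈ J, ∀ t ∈ J, x t' t = ∑ i, p i t' * q i t) {y : ℝ → ℂ}
    (hy : ContDiffOn ℝ ∞ y J) (n : ℕ) (φ : CausalFun J) {t' : ℝ} (ht' : t' ∈ J) :
    (sepOp hJ hc p q (mulOp J y ((derivOp hJ ^ n) φ)) : ℝ → ℂ) t' =
      (-1) ^ n * (primOp hJ hc (mulOp J
        (rightDeriv n (fun s' s => x s' s * y s) t') φ) : ℝ → ℂ) t' +
      ∑ i ∈ Finset.range n, (-1) ^ i * rightDeriv i (fun s' s => x s' s * y s) t' t' *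
        iteratedDeriv (n - 1 - i) (φ : ℝ → ℂ) t' := by
  have hqy : ∀ i, ContDiffOn ℝ ∞ (fun s => q i s * y s) J := fun i => (hq i).mul hy
  have hxy : ∀ t' ∈ J, ∀ t ∈ J, x t' t * y t = ∑ i, p i t' * (q i t * y t) :=
    fun t' ht' t ht => by rw [hx t' ht' t ht, Finset.sum_mul]; simp only [mul_assoc]
  have hR : ∀ m, ∀ t ∈ J, rightDeriv m (fun s' s => x s' s * y s) t' t =
      ∑ i, p i t' * iteratedDeriv m (fun s => q i s * y s) t := fun m t ht =>
    rightDeriv_sep hJ hqy hxy m ht' ht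
  have hRs : ContDiffOn ℝ ∞ (rightDeriv n (fun s' s => x s' s * y s) t') J :=
    ContDiffOn.congr (ContDiffOn.sum fun i _ =>
      contDiffOn_const.mul (contDiffOn_iteratedDeriv hJ (hqy i) n)) (hR n)
  have h1 : ∀ i, (mulOp J (p i) (primOp hJ hc (mulOp J (q i) (mulOp J y ((derivOp hJ ^ n) φ)))) :
      ℝ → ℂ) t' = (-1) ^ n * (p i t' * (primOp hJ hc (mulOp J
        (iteratedDeriv n fun s => q i s * y s) φ) : ℝ → ℂ) t') +
      ∑ m ∈ Finset.range n, (-1) ^ m * (p i t' * iteratedDeriv m (fun s => q i s * y s) t') *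
        iteratedDeriv (n - 1 - m) (φ : ℝ → ℂ) t' := by
    intro i
    have h := LinearMap.congr_fun (primOp_mul_mulOp_mul_derivOp_pow hJ hc (hqy i) n) φ
    rw [← mulOp_mul_mulOp (hq i) hy] at h
    simp only [Module.End.mul_apply] at h
    rw [mulOp_apply (hp i), h, LinearMap.add_apply, Submodule.coe_add, Pi.add_apply,
      genFun_sum_apply, mul_add, Finset.mul_sum]
    simp only [LinearMap.smul_apply, Submodule.coe_smul, Pi.smul_apply, smul_eq_mul,
      Module.End.mul_apply, mulOp_apply (contDiffOn_iteratedDeriv hJ (hqy i) _),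
      derivOp_pow_apply hJ _ _ ht']
    congr 1
    · ring
    · exact Finset.sum_congr rfl fun m _ => by ring
  rw [sepOp, genFun_sum_apply]
  simp only [Module.End.mul_apply, h1]
  rw [Finset.sum_add_distrib, ← Finset.mul_sum, Finset.sum_comm]
  congr 1
  · rw [← integral_mul_heaviside_mul hJ hc hRs φ ht']
    -- With `t'` frozen in the left factors, they are constants and `sepOp_apply` covers a kernel
    -- that depends on `t` alone.
    have h3 := sepOp_apply hJ hc (a := fun i _ => p i t')
      (b := fun i => iteratedDeriv n fun s => q i s * y s)
      (fun i => contDiffOn_const) (fun i => contDiffOn_iteratedDeriv hJ (hqy i) n)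
      (F := fun _ t => rightDeriv n (fun s' s => x s' s * y s) t' t)
      (fun _ _ t ht => hR n t ht) φ ht'
    rw [← h3, sepOp, genFun_sum_apply]
    simp only [Module.End.mul_apply, mulOp_apply contDiffOn_const]
  · refine Finset.sum_congr rfl fun m _ => ?_
    rw [hR m t' ht', Finset.mul_sum, Finset.sum_mul]

end SepDeriv

end GivenBy

section GivenBy

variable {J : Set ℝ}

/-! ### Joint smoothness of partial derivatives -/

lemma deriv_right_eq_fderiv (hJ : IsOpen J) {R : ℝ → ℝ → ℂ}
    (hR : ContDiffOn ℝ ∞ (Function.uncurry R) (J ×ˢ J)) {t' t : ℝ} (ht' : t' ∈ J) (ht : t ∈ J) :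
    deriv (fun s => R t' s) t = fderiv ℝ (Function.uncurry R) (t', t) (0, 1) := by
  have h1 := ((hR.contDiffAt (x := (t', t)) ((hJ.prod hJ).mem_nhds ⟨ht', ht⟩)).differentiableAt
    (by simp)).hasFDerivAt
  exact (h1.comp_hasDerivAt t ((hasDerivAt_const t t').prodMk (hasDerivAt_id t))).deriv

lemma deriv_left_eq_fderiv (hJ : IsOpen J) {R : ℝ → ℝ → ℂ}
    (hR : ContDiffOn ℝ ∞ (Function.uncurry R) (J ×ˢ J)) {t' t : ℝ} (ht' : t' ∈ J) (ht : t ∈ J) :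
    deriv (fun s => R s t) t' = fderiv ℝ (Function.uncurry R) (t', t) (1, 0) := by
  have h1 := ((hR.contDiffAt (x := (t', t)) ((hJ.prod hJ).mem_nhds ⟨ht', ht⟩)).differentiableAt
    (by simp)).hasFDerivAt
  exact (h1.comp_hasDerivAt t' ((hasDerivAt_id t').prodMk (hasDerivAt_const t' t))).deriv

lemma contDiffOn_rightDeriv (hJ : IsOpen J) {R : ℝ → ℝ → ℂ}
    (hR : ContDiffOn ℝ ∞ (Function.uncurry R) (J ×ˢ J)) (n : ℕ) :
    ContDiffOn ℝ ∞ (Function.uncurry (rightDeriv n R)) (J ×ˢ J) := by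
  induction n with
  | zero => simpa [rightDeriv, Function.uncurry_def] using hR
  | succ n ih =>
    refine ContDiffOn.congr (f := fun z => fderiv ℝ (Function.uncurry (rightDeriv n R)) z (0, 1))
      ((ih.fderiv_of_isOpen (hJ.prod hJ) (m := ∞) (by simp)).clm_apply contDiffOn_const) ?_
    rintro ⟨t', t⟩ ⟨ht', ht⟩
    rw [← deriv_right_eq_fderiv hJ ih ht' ht]
    simp [rightDeriv, iteratedDeriv_succ, Function.uncurry]

lemma contDiffOn_row {S : Set ℝ} {R : ℝ → ℝ → ℂ}
    (hR : ContDiffOn ℝ ∞ (Function.uncurry R) (S ×ˢ S)) {t' : ℝ} (ht' : t' ∈ S) :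
    ContDiffOn ℝ ∞ (R t') S :=
  hR.comp (contDiffOn_const.prodMk contDiffOn_id) fun _ ht => ⟨ht', ht⟩

lemma contDiffOn_diag {S : Set ℝ} {R : ℝ → ℝ → ℂ}
    (hR : ContDiffOn ℝ ∞ (Function.uncurry R) (S ×ˢ S)) : ContDiffOn ℝ ∞ (fun t => R t t) S :=
  hR.comp (contDiffOn_id.prodMk contDiffOn_id) fun _ ht => ⟨ht, ht⟩

lemma contDiffOn_mul_right {S : Set ℝ} {x : ℝ → ℝ → ℂ} {y : ℝ → ℂ}
    (hx : ContDiffOn ℝ ∞ (Function.uncurry x) (S ×ˢ S)) (hy : ContDiffOn ℝ ∞ y S) :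
    ContDiffOn ℝ ∞ (Function.uncurry fun s' s => x s' s * y s) (S ×ˢ S) :=
  hx.mul (hy.comp contDiffOn_snd fun _ hz => hz.2)

/-! ### Rearrangement of the sums -/

lemma sum_range_sum_range_eq {M : Type*} [AddCommMonoid M] (n : ℕ) (G : ℕ → ℕ → M) :
    ∑ j ∈ Finset.range (n + 1), ∑ m ∈ Finset.range j, G j m =
      ∑ m ∈ Finset.range n, ∑ j ∈ Finset.Icc (m + 1) n, G j m :=
  Finset.sum_comm' fun j m => by simp only [Finset.mem_range, Finset.mem_Icc]; omega

/-- Leibniz' rule turns the regular part of `(x Θ) ∗ L ∗ (F Θ)` into `∑ h_m x^{(0,m)}`. -/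
lemma sum_rightDeriv_eq_sum_hCoeff (hJ : IsOpen J) (F : ℝ → ℝ → ℂ) {k : ℕ} {g : ℕ → ℝ → ℂ}
    (hg : ∀ j ≤ k + 1, ContDiffOn ℝ ∞ (g j) J) {x : ℝ → ℝ → ℂ} {t' t : ℝ}
    (hx : ContDiffOn ℝ ∞ (x t') J) (ht : t ∈ J) :
    ∑ j ∈ Finset.range (k + 2), ∑ l ∈ Finset.range j,
        (-1) ^ l * rightDeriv l (fun s' s => x s' s * g j s) t' t * leftDeriv (j - l - 1) F t t =
      ∑ m ∈ Finset.range (k + 1), hCoeff F k g m t * rightDeriv m x t' t := by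
  have h1 : ∀ j ∈ Finset.range (k + 2), ∑ l ∈ Finset.range j,
      (-1) ^ l * rightDeriv l (fun s' s => x s' s * g j s) t' t * leftDeriv (j - l - 1) F t t =
      ∑ m ∈ Finset.range j, ∑ l ∈ Finset.Icc m (j - 1), (l.choose m : ℂ) * (-1) ^ l *
        leftDeriv (j - l - 1) F t t * iteratedDeriv (l - m) (g j) t * rightDeriv m x t' t := by
    intro j hj
    have hgj := hg j (by have := Finset.mem_range.1 hj; omega)
    have h2 : ∀ l, (-1) ^ l * rightDeriv l (fun s' s => x s' s * g j s) t' t *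
        leftDeriv (j - l - 1) F t t = ∑ m ∈ Finset.range (l + 1), (l.choose m : ℂ) * (-1) ^ l *
        leftDeriv (j - l - 1) F t t * iteratedDeriv (l - m) (g j) t * rightDeriv m x t' t := by
      intro l
      rw [rightDeriv, iteratedDeriv_fun_mul
        ((hx.contDiffAt (hJ.mem_nhds ht)).of_le (by exact_mod_cast le_top))
        ((hgj.contDiffAt (hJ.mem_nhds ht)).of_le (by exact_mod_cast le_top)),
        Finset.mul_sum, Finset.sum_mul]
      exact Finset.sum_congr rfl fun m _ => by rw [rightDeriv]; ring
    simp only [h2]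
    exact Finset.sum_comm' fun l m => by simp only [Finset.mem_range, Finset.mem_Icc]; omega
  rw [Finset.sum_congr rfl h1, sum_range_sum_range_eq]
  refine Finset.sum_congr rfl fun m _ => ?_
  simp only [hCoeff, Finset.sum_mul]

/-! ### The inverse -/

variable {F : ℝ → ℝ → ℂ} {k : ℕ} {g : ℕ → ℝ → ℂ} {ι : Type*} [Fintype ι] {a b : ι → ℝ → ℂ}

/-- Only `j = k + 1`, `ℓ = k` contribute. Thus `F(τ,τ) g_{k+1}(τ) ≠ 0` is exactly what makes the
equation for `x` regular. -/
lemma hCoeff_last (t : ℝ) : hCoeff F k g k t = (-1) ^ k * F t t * g (k + 1) t := by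
  simp [hCoeff, leftDeriv]

lemma contDiffOn_hCoeff (hJ : IsOpen J) (ha : ∀ i, ContDiffOn ℝ ∞ (a i) J)
    (hb : ∀ i, ContDiffOn ℝ ∞ (b i) J)
    (hF : ∀ t' ∈ J, ∀ t ∈ J, F t' t = ∑ i, a i t' * b i t)
    (hg : ∀ j ≤ k + 1, ContDiffOn ℝ ∞ (g j) J) (m : ℕ) : ContDiffOn ℝ ∞ (hCoeff F k g m) J :=
  ContDiffOn.sum fun j hj => ContDiffOn.sum fun _ _ =>
    (contDiffOn_const.mul (contDiffOn_leftDeriv_diag hJ ha hb hF _)).mul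
      (contDiffOn_iteratedDeriv hJ (hg j (Finset.mem_Icc.1 hj).2) _)

/-- A left inverse of a surjective operator is a two-sided inverse. -/
lemma mul_eq_one_of_surjective {S T : GenFun J} (hT : Function.Surjective T) (h : S * T = 1) :
    T * S = 1 := LinearMap.ext fun ψ => by
  obtain ⟨φ, rfl⟩ := hT ψ
  have := LinearMap.congr_fun h φ
  rw [Module.End.mul_apply, Module.End.one_apply] at this
  rw [Module.End.mul_apply, this, Module.End.one_apply]

/-- Reduces both cases, `k = 0` and `k > 0`, to a computation on one side: surjectivity, from the
non-vanishing diagonal, supplies the other. -/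
lemma isStarInverse_of_mul_sepOp_eq_one (hJ : IsOpen J) (hc : J.OrdConnected)
    (ha : ∀ i, ContDiffOn ℝ ∞ (a i) J) (hb : ∀ i, ContDiffOn ℝ ∞ (b i) J)
    (hF : ∀ t' ∈ J, ∀ t ∈ J, F t' t = ∑ i, a i t' * b i t) (hne : ∀ t ∈ J, F t t ≠ 0)
    {K : CausalKernel} (hK : K.SmoothOn J) {S : GenFun J} (hS : K.Represents S)
    (h : S * sepOp hJ hc a b = 1) : IsStarInverse J (thetaKernel F) K :=
  ⟨hK, sepOp hJ hc a b, S, sepOp_represents hJ hc ha hb hF, hS, h, mul_eq_one_of_surjective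
    (sepOp_surjective hJ hc ha hb fun t ht => by rw [← hF t ht t ht]; exact hne t ht) h⟩

/-- For `k = 0` a single jump term survives, so `L ∗ (F Θ)` is multiplication by `g_1(t) F(t,t)`. -/
theorem isStarInverse_inverseKernelZero (hJ : IsOpen J) (hc : J.OrdConnected)
    (ha : ∀ i, ContDiffOn ℝ ∞ (a i) J) (hb : ∀ i, ContDiffOn ℝ ∞ (b i) J)
    (hF : ∀ t' ∈ J, ∀ t ∈ J, F t' t = ∑ i, a i t' * b i t) (hg : IsAnnihilator J F 0 g)
    (hne : ∀ τ ∈ J, F τ τ ≠ 0 ∧ g 1 τ ≠ 0) :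
    IsStarInverse J (thetaKernel F) (inverseKernelZero F g) := by
  have hFs : ContDiffOn ℝ ∞ (fun t => F t t) J := by
    simpa [leftDeriv] using contDiffOn_leftDeriv_diag hJ ha hb hF 0
  have hgs : ∀ j < 2, ContDiffOn ℝ ∞ (g j) J := fun j hj => hg.1 j (by omega)
  have hinv : ContDiffOn ℝ ∞ (fun t => (g 1 t * F t t)⁻¹) J :=
    ((hgs 1 (by omega)).mul hFs).inv fun t ht => mul_ne_zero (hne t ht).2 (hne t ht).1
  refine isStarInverse_of_mul_sepOp_eq_one hJ hc ha hb hF (fun t ht => (hne t ht).1)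
    ⟨contDiffOn_const, fun m hm => hinv.mul (hgs m hm)⟩
    (S := mulOp J (fun t => (g 1 t * F t t)⁻¹) * diffOp hJ 2 g) (fun φ t' ht' => ?_) ?_
  · rw [Module.End.mul_apply, mulOp_apply hinv, diffOp_apply hJ hgs φ ht']
    simp [inverseKernelZero, Finset.sum_range_succ, mul_add, mul_assoc]
  · rw [mul_assoc, diffOp_mul_sepOp hJ hc ha hb hF hg]
    simp only [zero_add, Finset.sum_range_succ, Finset.range_zero, Finset.sum_empty, pow_zero,
      mul_one, Nat.sub_zero, Nat.sub_self, leftDeriv, iteratedDeriv_zero]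
    rw [mulOp_mul_mulOp (hgs 1 (by omega)) hFs,
      mulOp_mul_mulOp hinv ((hgs 1 (by omega)).mul hFs)]
    exact mulOp_one fun t ht => inv_mul_cancel₀ (mul_ne_zero (hne t ht).2 (hne t ht).1)

/-! ### The case `k > 0`: the Green's function -/

section Positive

variable {x : ℝ → ℝ → ℂ} {p q : ι → ℝ → ℂ}

lemma smoothOn_inverseKernel (hJ : IsOpen J) (hg : ∀ j ≤ k + 1, ContDiffOn ℝ ∞ (g j) J)
    (hx : ContDiffOn ℝ ∞ (Function.uncurry x) (J ×ˢ J)) : (inverseKernel k g x).SmoothOn J := by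
  have h1 : ∀ j ≤ k + 1, ContDiffOn ℝ ∞ (Function.uncurry fun s' s => x s' s * g j s) (J ×ˢ J) :=
    fun j hj => contDiffOn_mul_right hx (hg j hj)
  refine ⟨?_, fun m _ => ContDiffOn.sum fun j hj => contDiffOn_const.mul (contDiffOn_diag
    (contDiffOn_rightDeriv hJ (h1 j (Finset.mem_Icc.1 hj).2) _))⟩
  have h2 : ∀ j ∈ Finset.range (k + 2), ContDiffOn ℝ ∞ (fun z : ℝ × ℝ => (-1) ^ j *
      Function.uncurry (rightDeriv j fun s' s => x s' s * g j s) z) (J ×ˢ J) := fun j hj =>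
    contDiffOn_const.mul (contDiffOn_rightDeriv hJ
      (h1 j (by have := Finset.mem_range.1 hj; omega)) j)
  exact ContDiffOn.sum h2

lemma inverseKernel_represents (hJ : IsOpen J) (hc : J.OrdConnected)
    (hp : ∀ i, ContDiffOn ℝ ∞ (p i) J) (hq : ∀ i, ContDiffOn ℝ ∞ (q i) J)
    (hxpq : ∀ t' ∈ J, ∀ t ∈ J, x t' t = ∑ i, p i t' * q i t)
    (hx : ContDiffOn ℝ ∞ (Function.uncurry x) (J ×ˢ J))
    (hg : ∀ j ≤ k + 1, ContDiffOn ℝ ∞ (g j) J) :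
    (inverseKernel k g x).Represents (sepOp hJ hc p q * diffOp hJ (k + 2) g) := by
  intro φ t' ht'
  have hg' : ∀ j ∈ Finset.range (k + 2), ContDiffOn ℝ ∞ (g j) J := fun j hj =>
    hg j (by have := Finset.mem_range.1 hj; omega)
  have hRs : ∀ j ∈ Finset.range (k + 2),
      ContDiffOn ℝ ∞ (rightDeriv j (fun s' s => x s' s * g j s) t') J := fun j hj =>
    contDiffOn_row (contDiffOn_rightDeriv hJ (contDiffOn_mul_right hx (hg' j hj)) j) ht'
  have hreg := (smoothOn_inverseKernel hJ hg hx).1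
  rw [integral_mul_heaviside_mul hJ hc (contDiffOn_row hreg ht') φ ht', diffOp, Finset.mul_sum,
    genFun_sum_apply]
  simp only [Module.End.mul_apply]
  rw [Finset.sum_congr rfl fun j hj =>
    sepOp_mul_derivOp_pow_apply hJ hc hp hq hxpq (hg' j hj) j φ ht', Finset.sum_add_distrib]
  congr 1
  · have h1 : mulOp J ((inverseKernel k g x).reg t') φ = ∑ j ∈ Finset.range (k + 2),
        (-1 : ℂ) ^ j • mulOp J (rightDeriv j (fun s' s => x s' s * g j s) t') φ := by
      refine causalFun_ext fun t ht => ?_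
      rw [mulOp_apply (contDiffOn_row hreg ht'), Submodule.coe_sum, Finset.sum_apply]
      simp only [inverseKernel, Finset.sum_mul]
      refine Finset.sum_congr rfl fun j hj => ?_
      rw [Submodule.coe_smul, Pi.smul_apply, mulOp_apply (hRs j hj), smul_eq_mul, mul_assoc]
    rw [h1, map_sum, Submodule.coe_sum, Finset.sum_apply]
    refine Finset.sum_congr rfl fun j _ => ?_
    rw [map_smul, Submodule.coe_smul, Pi.smul_apply, smul_eq_mul]
  · have h1 : ∀ j, ∑ i ∈ Finset.range j, (-1) ^ i *
        rightDeriv i (fun s' s => x s' s * g j s) t' t' *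
          iteratedDeriv (j - 1 - i) (φ : ℝ → ℂ) t' =
        ∑ m ∈ Finset.range j, (-1) ^ (j + m + 1) *
          rightDeriv (j - 1 - m) (fun s' s => x s' s * g j s) t' t' *
          iteratedDeriv m (φ : ℝ → ℂ) t' := fun j => by
      rw [← Finset.sum_range_reflect]
      refine Finset.sum_congr rfl fun m hm => ?_
      have hm := Finset.mem_range.1 hm
      -- After the reflection `i = j - 1 - m` the sign is `(-1)^(j - 1 - m)`, which equals `(-1)^(j
      -- + m + 1)` since the exponents differ by `2 (m + 1)`.
      rw [show j - 1 - (j - 1 - m) = m by omega,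
        show j + m + 1 = (j - 1 - m) + 2 * (m + 1) by omega, pow_add _ _ (2 * (m + 1)), pow_mul]
      simp
    simp only [h1]
    rw [sum_range_sum_range_eq]
    simp only [inverseKernel, Finset.sum_mul]

/-- Since `L ∗ (F Θ)` has no regular part, integrating by parts against `x Θ` leaves an integral and
boundary terms. The integrand carries the factor `∑ h_m x^{(0,m)} = 0`, and the Cauchy data of `x`
leave one boundary term, equal to `φ t'`. -/
lemma sepOp_mul_diffOp_mul_sepOp (hJ : IsOpen J) (hc : J.OrdConnected) {κ : Type*} [Fintype κ]
    {p q : κ → ℝ → ℂ}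
    (ha : ∀ i, ContDiffOn ℝ ∞ (a i) J) (hb : ∀ i, ContDiffOn ℝ ∞ (b i) J)
    (hF : ∀ t' ∈ J, ∀ t ∈ J, F t' t = ∑ i, a i t' * b i t) (hg : IsAnnihilator J F k g)
    (hne : ∀ τ ∈ J, F τ τ ≠ 0 ∧ g (k + 1) τ ≠ 0) (hk : 0 < k)
    (hp : ∀ i, ContDiffOn ℝ ∞ (p i) J) (hq : ∀ i, ContDiffOn ℝ ∞ (q i) J)
    (hxpq : ∀ t' ∈ J, ∀ t ∈ J, x t' t = ∑ i, p i t' * q i t)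
    (hx : ContDiffOn ℝ ∞ (Function.uncurry x) (J ×ˢ J))
    (hsol : IsAdjointSolution J k (hCoeff F k g) x) :
    sepOp hJ hc p q * diffOp hJ (k + 2) g * sepOp hJ hc a b = 1 := by
  have hg' : ∀ j ∈ Finset.range (k + 2), ContDiffOn ℝ ∞ (g j) J := fun j hj =>
    hg.1 j (by have := Finset.mem_range.1 hj; omega)
  have hf : ∀ r, ContDiffOn ℝ ∞ (fun t => leftDeriv r F t t) J :=
    contDiffOn_leftDeriv_diag hJ ha hb hF
  refine genFun_ext fun φ t' ht' => ?_
  obtain ⟨hxs, hxe, hx0, hxk⟩ := hsol t' ht'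
  have hRs : ∀ j ∈ Finset.range (k + 2), ∀ l,
      ContDiffOn ℝ ∞ (rightDeriv l (fun s' s => x s' s * g j s) t') J := fun j hj l =>
    contDiffOn_row (contDiffOn_rightDeriv hJ (contDiffOn_mul_right hx (hg' j hj)) l) ht'
  -- In Leibniz' rule all terms but the last contain `x^{(0,m)}(t',t')` with `m ≤ k - 2`, which is
  -- `0`.
  have hleib : ∀ j ∈ Finset.range (k + 2), ∀ i < k,
      rightDeriv i (fun s' s => x s' s * g j s) t' t' = rightDeriv i x t' t' * g j t' := by
    intro j hj i hi
    rw [rightDeriv, iteratedDeriv_fun_mul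
      ((hxs.contDiffAt (hJ.mem_nhds ht')).of_le (by exact_mod_cast le_top))
      (((hg' j hj).contDiffAt (hJ.mem_nhds ht')).of_le (by exact_mod_cast le_top)),
      Finset.sum_range_succ, Finset.sum_eq_zero, zero_add]
    · simp [rightDeriv]
    · intro m hm
      have := hx0 m (by have := Finset.mem_range.1 hm; omega)
      rw [rightDeriv] at this
      rw [this, mul_zero, zero_mul]
  rw [mul_assoc, diffOp_mul_sepOp hJ hc ha hb hF hg, Module.End.mul_apply, Module.End.one_apply,
    LinearMap.sum_apply, map_sum, Submodule.coe_sum, Finset.sum_apply]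
  have h1 : ∀ j ∈ Finset.range (k + 2),
      (sepOp hJ hc p q ((∑ l ∈ Finset.range j, mulOp J (g j) * derivOp hJ ^ l *
        mulOp J (fun t => leftDeriv (j - l - 1) F t t)) φ) : ℝ → ℂ) t' =
      ∑ l ∈ Finset.range j, (primOp hJ hc ((-1 : ℂ) ^ l • mulOp J
        (rightDeriv l (fun s' s => x s' s * g j s) t')
        (mulOp J (fun t => leftDeriv (j - l - 1) F t t) φ)) : ℝ → ℂ) t' +
      ∑ l ∈ Finset.range j, ∑ i ∈ Finset.range l, (-1) ^ i * (rightDeriv i x t' t' * g j t') *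
        iteratedDeriv (l - 1 - i)
          (mulOp J (fun t => leftDeriv (j - l - 1) F t t) φ : ℝ → ℂ) t' := by
    intro j hj
    rw [LinearMap.sum_apply, map_sum, Submodule.coe_sum, Finset.sum_apply, ← Finset.sum_add_distrib]
    refine Finset.sum_congr rfl fun l hl => ?_
    simp only [Module.End.mul_apply]
    rw [sepOp_mul_derivOp_pow_apply hJ hc hp hq hxpq (hg' j hj) l _ ht', map_smul,
      Submodule.coe_smul, Pi.smul_apply, smul_eq_mul]
    congr 1
    refine Finset.sum_congr rfl fun i hi => ?_
    rw [hleib j hj i (by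
      have := Finset.mem_range.1 hj; have := Finset.mem_range.1 hl
      have := Finset.mem_range.1 hi; omega)]
  rw [Finset.sum_congr rfl h1, Finset.sum_add_distrib]
  have hbulk : ∑ j ∈ Finset.range (k + 2), ∑ l ∈ Finset.range j,
      (primOp hJ hc ((-1 : ℂ) ^ l • mulOp J (rightDeriv l (fun s' s => x s' s * g j s) t')
        (mulOp J (fun t => leftDeriv (j - l - 1) F t t) φ)) : ℝ → ℂ) t' = 0 := by
    have h2 : ∑ j ∈ Finset.range (k + 2), ∑ l ∈ Finset.range j,
        ((-1 : ℂ) ^ l • mulOp J (rightDeriv l (fun s' s => x s' s * g j s) t')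
          (mulOp J (fun t => leftDeriv (j - l - 1) F t t) φ)) = 0 := by
      refine causalFun_ext fun t ht => ?_
      have h3 := sum_rightDeriv_eq_sum_hCoeff hJ F hg.1 hxs ht
      rw [hxe t ht] at h3
      have h4 := congrArg (· * (φ : ℝ → ℂ) t) h3
      simp only [Finset.sum_mul, zero_mul] at h4
      simp only [Submodule.coe_sum, Finset.sum_apply, Submodule.coe_smul, Pi.smul_apply,
        smul_eq_mul, ZeroMemClass.coe_zero, Pi.zero_apply]
      rw [← h4]
      refine Finset.sum_congr rfl fun j hj => Finset.sum_congr rfl fun l _ => ?_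
      rw [mulOp_apply (hRs j hj l), mulOp_apply (hf _)]
      ring
    have h5 := congrArg (fun ψ : CausalFun J => (primOp hJ hc ψ : ℝ → ℂ) t') h2
    simpa only [map_sum, Submodule.coe_sum, Finset.sum_apply, map_zero, ZeroMemClass.coe_zero,
      Pi.zero_apply] using h5
  rw [hbulk, zero_add]
  -- As `i < l < j ≤ k + 1`, one has `i ≤ k - 1`, with equality only for `l = k` and `j = k + 1`;
  -- smaller `i` meet the null Cauchy data.
  have hterm : ∀ j ∈ Finset.range (k + 2), ∀ l ∈ Finset.range j, ∀ i ∈ Finset.range l,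
      ¬ (j = k + 1 ∧ l = k ∧ i = k - 1) → (-1) ^ i * (rightDeriv i x t' t' * g j t') *
        iteratedDeriv (l - 1 - i)
          (mulOp J (fun t => leftDeriv (j - l - 1) F t t) φ : ℝ → ℂ) t' = 0 := by
    intro j hj l hl i hi h
    simp only [Finset.mem_range] at hj hl hi
    rw [hx0 i (by omega)]
    ring
  rw [Finset.sum_eq_single_of_mem (k + 1) (by simp) (fun j hj hjk => Finset.sum_eq_zero fun l hl =>
      Finset.sum_eq_zero fun i hi => hterm j hj l hl i hi fun h => hjk h.1),
    Finset.sum_eq_single_of_mem k (by simp) (fun l hl hlk => Finset.sum_eq_zero fun i hi =>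
      hterm (k + 1) (by simp) l hl i hi fun h => hlk h.2.1),
    Finset.sum_eq_single_of_mem (k - 1) (by simp; omega) (fun i hi hik =>
      hterm (k + 1) (by simp) k (by simp) i hi fun h => hik h.2.2)]
  -- The remaining coefficient is `(-1)^(k-1) (-1/h_k) g_{k+1} F`, which is `1` because `h_k =
  -- (-1)^k F g_{k+1}`: this fixes the normalization of `x`.
  obtain ⟨n, rfl⟩ : ∃ n, k = n + 1 := ⟨k - 1, by omega⟩
  rw [hxk, hCoeff_last, show n + 1 - 1 - (n + 1 - 1) = 0 by omega, iteratedDeriv_zero,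
    mulOp_apply (hf _), show n + 1 + 1 - (n + 1) - 1 = 0 by omega, Nat.add_sub_cancel]
  simp only [leftDeriv, iteratedDeriv_zero]
  have h1 := (hne t' ht').1
  have h2 := (hne t' ht').2
  have h3 : ((-1 : ℂ)) ^ n ≠ 0 := pow_ne_zero _ (by norm_num)
  rw [pow_succ]
  field_simp

end Positive

/-- The inverse computed from an operator that annihilates `F`. -/
theorem starInverseGivenBy (hJ : IsOpen J) (hc : J.OrdConnected)
    (hF : ContDiffOn ℝ ∞ (Function.uncurry F) (J ×ˢ J)) (hsep : IsSeparableOn F J)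
    (hg : IsAnnihilator J F k g) (hne : ∀ τ ∈ J, F τ τ ≠ 0 ∧ g (k + 1) τ ≠ 0) :
    StarInverseGivenBy J F k g := by
  obtain ⟨n, a, b, ha, hb, hab⟩ := hsep.exists_smooth_factors hF
  refine ⟨?_, fun hk => ?_⟩
  · rintro rfl
    exact isStarInverse_inverseKernelZero hJ hc ha hb hab hg hne
  · have hh : ∀ m ≤ k, ContDiffOn ℝ ∞ (hCoeff F k g m) J := fun m _ =>
      contDiffOn_hCoeff hJ ha hb hab hg.1 m
    have hhk : ∀ t ∈ J, hCoeff F k g k t ≠ 0 := fun t ht => by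
      rw [hCoeff_last]
      exact mul_ne_zero (mul_ne_zero (pow_ne_zero _ (by norm_num)) (hne t ht).1) (hne t ht).2
    obtain ⟨p, q, hp, hq, hsol⟩ := exists_adjointSolution hJ hc hh hhk hk
    have hxs : ContDiffOn ℝ ∞ (Function.uncurry fun t' t => ∑ i, p i t' * q i t) (J ×ˢ J) :=
      ContDiffOn.sum fun i _ => ((hp i).comp contDiffOn_fst fun z hz => hz.1).mul
        ((hq i).comp contDiffOn_snd fun z hz => hz.2)
    refine ⟨_, hsol, fun x' hx' => adjointSolution_unique hJ hc hh hhk hk hsol hx', hxs, ?_⟩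
    exact isStarInverse_of_mul_sepOp_eq_one hJ hc ha hb hab (fun t ht => (hne t ht).1)
      (smoothOn_inverseKernel hJ hg.1 hxs)
      (inverseKernel_represents hJ hc hp hq (fun _ _ _ _ => rfl) hxs hg.1)
      (sepOp_mul_diffOp_mul_sepOp hJ hc ha hb hab hg hne hk hp hq (fun _ _ _ _ => rfl) hxs hsol)

end GivenBy

/-! ### The operator given by the Wronskian -/

section Wronskian

variable {k : ℕ} {y a : Fin (k + 1) → ℝ → ℂ} {F : ℝ → ℝ → ℂ} {I J : Set ℝ}

/-- Cramer's identity `M (cramer M b) = (det M) b` involves no division, so it also holds at the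
zeros of the Wronskian. Taking `W` itself as leading coefficient is what allows this. -/
lemma sum_wronskianOp_mul_iteratedDeriv (y : Fin (k + 1) → ℝ → ℂ) (t : ℝ) (i : Fin (k + 1)) :
    ∑ j ∈ Finset.range (k + 2), wronskianOp y j t * iteratedDeriv j (y i) t = 0 := by
  have h := congrFun (Matrix.mulVec_cramer (wronskiMatrix y t)
    (fun i => iteratedDeriv (k + 1) (y i) t)) i
  simp only [Matrix.mulVec, dotProduct, Pi.smul_apply, smul_eq_mul] at h
  rw [Finset.sum_range_succ, ← Fin.sum_univ_eq_sum_range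
    (fun j => wronskianOp y j t * iteratedDeriv j (y i) t)]
  simp only [wronskianOp, Fin.is_lt, dif_pos, lt_irrefl, dif_neg, not_false_eq_true, Fin.eta,
    wronskian, ← h]
  rw [← Finset.sum_add_distrib]
  exact Finset.sum_eq_zero fun j _ => by simp [wronskiMatrix]; ring

lemma contDiffOn_wronskian (hJ : IsOpen J) (hy : ∀ i, ContDiffOn ℝ ∞ (y i) J) :
    ContDiffOn ℝ ∞ (wronskian y) J :=
  contDiffOn_det fun i j => contDiffOn_iteratedDeriv hJ (hy i) j

lemma contDiffOn_wronskianOp (hJ : IsOpen J) (hy : ∀ i, ContDiffOn ℝ ∞ (y i) J) (j : ℕ) :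
    ContDiffOn ℝ ∞ (wronskianOp y j) J := by
  unfold wronskianOp
  by_cases hj : j < k + 1
  · simp only [hj, dif_pos]
    exact (contDiffOn_cramer (fun i j => contDiffOn_iteratedDeriv hJ (hy i) j)
      (fun i => contDiffOn_iteratedDeriv hJ (hy i) (k + 1)) _).neg
  · simp only [hj, dif_neg, not_false_eq_true]
    exact contDiffOn_wronskian hJ hy

theorem isAnnihilator_wronskianOp (hJ : IsOpen J) (hy : ∀ i, ContDiffOn ℝ ∞ (y i) J)
    (hF : ∀ t' ∈ J, ∀ t ∈ J, F t' t = ∑ i, a i t * y i t') :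
    IsAnnihilator J F k (wronskianOp y) := by
  refine ⟨fun j _ => contDiffOn_wronskianOp hJ hy j, fun t' ht' t ht => ?_⟩
  have hF' : ∀ t' ∈ J, ∀ t ∈ J, F t' t = ∑ i, y i t' * a i t := fun t' ht' t ht => by
    rw [hF t' ht' t ht]; simp only [mul_comm]
  simp only [leftDeriv_sep hJ hy hF' _ ht' ht, Finset.mul_sum]
  rw [Finset.sum_comm]
  refine Finset.sum_eq_zero fun i _ => ?_
  simp only [← mul_assoc]
  rw [← Finset.sum_mul, sum_wronskianOp_mul_iteratedDeriv, zero_mul]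

lemma IsSeparableOn.mono (hsep : IsSeparableOn F I) (hJI : J ⊆ I) : IsSeparableOn F J := by
  obtain ⟨n, a, b, hab⟩ := hsep
  exact ⟨n, a, b, fun t' ht' t ht => hab t' (hJI ht') t (hJI ht)⟩

lemma volume_sdiff_interior (hI : I.OrdConnected) : volume (I \ interior I) = 0 :=
  measure_mono_null (sdiff_subset_sdiff_left subset_closure)
    (hI.convex.addHaar_frontier volume)

theorem starInverseGivenByAE_wronskianOp (hI : I.OrdConnected)
    (hF : ContDiffOn ℝ ∞ (Function.uncurry F) (I ×ˢ I)) (hsep : IsSeparableOn F I)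
    (hy : ∀ i, ContDiffOn ℝ ∞ (y i) I)
    (hFy : ∀ t' ∈ I, ∀ t ∈ I, F t' t = ∑ i, a i t * y i t')
    (hnull : volume {τ ∈ I | F τ τ = 0 ∨ wronskian y τ = 0} = 0) :
    StarInverseGivenByAE I F k (wronskianOp y) := by
  have hIint : interior I ⊆ I := interior_subset
  have hc1 : ContinuousOn (fun t => F t t) (interior I) :=
    (contDiffOn_diag hF).continuousOn.mono hIint
  have hc2 : ContinuousOn (wronskian y) (interior I) :=
    (contDiffOn_wronskian isOpen_interior fun i => (hy i).mono hIint).continuousOn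
  -- The good set is the part of the interior where `F(t,t) W(t) ≠ 0`: open by continuity, and of
  -- full measure because an interval has a null boundary.
  refine ⟨interior I ∩ (fun t => F t t * wronskian y t) ⁻¹' {0}ᶜ, fun t ht => hIint ht.1,
    (hc1.mul hc2).isOpen_inter_preimage isOpen_interior isOpen_compl_singleton, ?_, ?_⟩
  · refine measure_mono_null ?_ (measure_union_null (volume_sdiff_interior hI) hnull)
    intro t ht
    by_cases hti : t ∈ interior I
    · refine Or.inr ⟨ht.1, ?_⟩
      by_contra h
      push Not at h
      exact ht.2 ⟨hti, mul_ne_zero h.1 h.2⟩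
    · exact Or.inl ⟨ht.1, hti⟩
  · intro J hJU hJ hJc
    have hJI : J ⊆ I := fun t ht => hIint (hJU ht).1
    have hann : IsAnnihilator J F k (wronskianOp y) :=
      isAnnihilator_wronskianOp hJ (fun i => (hy i).mono hJI)
        fun t' ht' t ht => hFy t' (hJI ht') t (hJI ht)
    refine ⟨hann, starInverseGivenBy hJ hJc (hF.mono (prod_mono hJI hJI)) (hsep.mono hJI) hann
      fun τ hτ => ?_⟩
    have h := mul_ne_zero_iff.1 (hJU hτ).2
    exact ⟨h.1, by simpa [wronskianOp] using h.2⟩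

end Wronskian

/-! ### Wronskians of analytic functions -/

section Analytic

variable {J : Set ℝ}

lemma analyticOnNhd_iteratedDeriv {f : ℝ → ℂ} (hf : AnalyticOnNhd ℝ f J) (n : ℕ) :
    AnalyticOnNhd ℝ (iteratedDeriv n f) J := by
  rw [iteratedDeriv_eq_iterate]; exact hf.iterated_deriv n

lemma analyticOnNhd_det {ι : Type*} [Fintype ι] [DecidableEq ι] {M : ℝ → Matrix ι ι ℂ}
    (hM : ∀ i j, AnalyticOnNhd ℝ (fun t => M t i j) J) :
    AnalyticOnNhd ℝ (fun t => (M t).det) J := by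
  simp only [Matrix.det_apply']
  exact Finset.analyticOnNhd_fun_sum _ fun σ _ =>
    analyticOnNhd_const.mul (Finset.analyticOnNhd_fun_prod _ fun i _ => hM _ _)

/-- The zeros of a non-null analytic function on an interval form a null set. -/
lemma volume_zeros_eq_zero (hJ : IsOpen J) (hc : J.OrdConnected) {f : ℝ → ℂ}
    (hf : AnalyticOnNhd ℝ f J) (hne : ∃ t ∈ J, f t ≠ 0) : volume {t ∈ J | f t = 0} = 0 := by
  rcases hf.eqOn_zero_or_eventually_ne_zero_of_preconnected hc.isPreconnected with h | h
  · obtain ⟨t, ht, hne⟩ := hne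
    exact absurd (h ht) hne
  · have := ae_restrict_le_codiscreteWithin (μ := volume) hJ.measurableSet h
    rw [mem_ae_iff, Measure.restrict_apply' hJ.measurableSet] at this
    refine measure_mono_null (t := {t | f t ≠ 0}ᶜ ∩ J) (fun t ht => ⟨?_, ht.1⟩) this
    simpa using ht.2

/-- The matrix of the Wronskian, for any number of functions. -/
def derivMatrix {n : ℕ} (y : Fin n → ℝ → ℂ) (t : ℝ) : Matrix (Fin n) (Fin n) ℂ :=
  Matrix.of fun i j => iteratedDeriv j (y i) t

/-- If the first Wronskian does not vanish on an open interval and the second one does, then the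
last function is a linear combination of the others. -/
lemma exists_linear_combination_of_det_eq_zero {V : Set ℝ} (hV : IsOpen V)
    (hVc : V.OrdConnected) {n : ℕ} {y : Fin n → ℝ → ℂ} {z : ℝ → ℂ}
    (hy : ∀ i, ContDiffOn ℝ ∞ (y i) V) (hz : ContDiffOn ℝ ∞ z V)
    (hne : ∀ t ∈ V, (derivMatrix y t).det ≠ 0)
    (h0 : ∀ t ∈ V, (derivMatrix (Fin.snoc (α := fun _ => ℝ → ℂ) y z) t).det = 0) :
    ∃ c : Fin n → ℂ, ∀ t ∈ V, z t = ∑ i, c i * y i t := by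
  rcases V.eq_empty_or_nonempty with rfl | ⟨t₀, ht₀⟩
  · exact ⟨0, fun t ht => absurd ht (notMem_empty t)⟩
  have hkill : ∀ t ∈ V, ∀ v : Fin n → ℂ, (∀ j < n, ∑ i, v i * iteratedDeriv j (y i) t = 0) →
      v = 0 := fun t ht v hv => Matrix.eq_zero_of_vecMul_eq_zero (hne t ht) (funext fun j => by
    simpa [Matrix.vecMul, dotProduct, derivMatrix] using hv j j.2)
  -- At each point the rows of the large matrix are dependent and those of the small one are not, so
  -- the row of `z` is a combination of the others, in all columns `j ≤ n`.
  have hpt : ∀ t ∈ V, ∃ c : Fin n → ℂ, ∀ j ≤ n,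
      iteratedDeriv j z t = ∑ i, c i * iteratedDeriv j (y i) t := by
    intro t ht
    obtain ⟨v, hv, hv0⟩ := Matrix.exists_vecMul_eq_zero_iff.2 (h0 t ht)
    have hsum : ∀ j ≤ n, ∑ i : Fin n, v i.castSucc * iteratedDeriv j (y i) t +
        v (Fin.last n) * iteratedDeriv j z t = 0 := fun j hj => by
      have := congrFun hv0 ⟨j, by omega⟩
      simpa [Matrix.vecMul, dotProduct, derivMatrix, Fin.sum_univ_castSucc] using this
    have hlast : v (Fin.last n) ≠ 0 := by
      intro hl
      have h1 := hkill t ht (fun i => v i.castSucc) fun j hj => by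
        simpa [hl] using hsum j hj.le
      refine hv (funext fun i => ?_)
      refine Fin.lastCases hl (fun i => congrFun h1 i) i
    refine ⟨fun i => -(v (Fin.last n))⁻¹ * v i.castSucc, fun j hj => ?_⟩
    simp only [mul_assoc, ← Finset.mul_sum]
    rw [eq_neg_of_add_eq_zero_left (hsum j hj)]
    field_simp
  choose! c hc using hpt
  have hcs : ∀ i, ContDiffOn ℝ ∞ (fun t => c t i) V := by
    intro i
    have hM : ∀ i j, ContDiffOn ℝ ∞ (fun t => (derivMatrix y t).transpose i j) V := fun i j =>
      contDiffOn_iteratedDeriv hV (hy j) i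
    refine ContDiffOn.congr (((contDiffOn_det hM).inv fun t ht => by
      rw [Matrix.det_transpose]; exact hne t ht).mul (contDiffOn_cramer hM
        (b := fun t (j : Fin n) => iteratedDeriv j z t)
        (fun j => contDiffOn_iteratedDeriv hV hz j) i))
      fun t ht => ?_
    have h1 : (fun j : Fin n => iteratedDeriv (j : ℕ) z t) =
        (derivMatrix y t).transpose.mulVec (c t) := funext fun j => by
      rw [hc t ht j j.2.le]
      simp [Matrix.mulVec, dotProduct, derivMatrix, mul_comm]
    rw [h1, Matrix.cramer_eq_adjugate_mulVec, Matrix.mulVec_mulVec, Matrix.adjugate_mul,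
      Matrix.smul_mulVec, Matrix.one_mulVec, Pi.smul_apply, smul_eq_mul, Pi.inv_apply,
      inv_mul_cancel_left₀]
    rw [Matrix.det_transpose]; exact hne t ht
  -- Differentiating the relation of order `j < n` and subtracting that of order `j + 1` leaves `∑
  -- c_i' y_i^{(j)} = 0`; the first Wronskian forces `c' = 0`.
  have hderiv : ∀ t ∈ V, ∀ i, deriv (fun t => c t i) t = 0 := by
    intro t ht
    refine congrFun (hkill t ht _ fun j hj => ?_)
    have h1 : HasDerivAt (fun t => ∑ i, c t i * iteratedDeriv j (y i) t)
        (∑ i, (deriv (fun t => c t i) t * iteratedDeriv j (y i) t +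
          c t i * iteratedDeriv (j + 1) (y i) t)) t :=
      HasDerivAt.fun_sum fun i _ => (hasDerivAt_of_contDiffOn hV (hcs i) ht).fun_mul
        (hasDerivAt_iteratedDeriv hV (hy i) j ht)
    have h2 := (hasDerivAt_iteratedDeriv hV hz j ht).congr_of_eventuallyEq
      (f₁ := fun t => ∑ i, c t i * iteratedDeriv j (y i) t)
      (Filter.eventually_of_mem (hV.mem_nhds ht) fun s hs => (hc s hs j hj.le).symm)
    have h3 := h1.unique h2
    rw [Finset.sum_add_distrib, ← hc t ht (j + 1) hj] at h3
    exact add_eq_right.1 h3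
  refine ⟨c t₀, fun t ht => ?_⟩
  have hconst : ∀ i, c t i = c t₀ i := fun i =>
    hV.is_const_of_deriv_eq_zero hVc.isPreconnected
      ((hcs i).differentiableOn (by simp)) (fun s hs => hderiv s hs i) ht ht₀
  simpa [hconst] using hc t ht 0 (Nat.zero_le n)

/-- The Wronskian of linearly independent analytic functions is not identically null. -/
theorem exists_det_derivMatrix_ne_zero (hJ : IsOpen J) (hc : J.OrdConnected) (hJne : J.Nonempty)
    {n : ℕ} {y : Fin n → ℝ → ℂ} (hy : ∀ i, AnalyticOnNhd ℝ (y i) J)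
    (hli : ∀ c : Fin n → ℂ, (∀ t ∈ J, ∑ i, c i * y i t = 0) → c = 0) :
    ∃ t ∈ J, (derivMatrix y t).det ≠ 0 := by
  induction n with
  | zero => exact ⟨hJne.some, hJne.some_mem, by simp⟩
  | succ n ih =>
    by_contra! hzero
    -- By induction the Wronskian without the last function is non-zero at some `t₀`, hence on a
    -- ball; there the last function is a combination of the others.
    obtain ⟨t₀, ht₀, hne⟩ := ih (y := fun i => y i.castSucc) (fun i => hy _) (fun c hc' => by
      have := hli (Fin.snoc (α := fun _ => ℂ) c 0) fun t ht => by
        simpa [Fin.sum_univ_castSucc] using hc' t ht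
      funext i
      simpa using congrFun this i.castSucc)
    have hs : ∀ i, ContDiffOn ℝ ∞ (y i) J := fun i => (hy i).contDiffOn_of_completeSpace
    have hcont : ContinuousOn (fun t => (derivMatrix (fun i => y (Fin.castSucc i)) t).det) J :=
      (contDiffOn_det fun (i j : Fin n) =>
        contDiffOn_iteratedDeriv hJ (hs i.castSucc) j).continuousOn
    obtain ⟨ε, hε, hball⟩ := Metric.isOpen_iff.1
      (hcont.isOpen_inter_preimage hJ (isOpen_compl_singleton (x := (0 : ℂ)))) t₀ ⟨ht₀, hne⟩
    have hVJ : Metric.ball t₀ ε ⊆ J := fun t ht => (hball ht).1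
    have hsnoc : Fin.snoc (α := fun _ => ℝ → ℂ) (fun i => y (Fin.castSucc i)) (y (Fin.last n)) =
        y := Fin.snoc_init_self (α := fun _ => ℝ → ℂ) y
    obtain ⟨c, hcz⟩ := exists_linear_combination_of_det_eq_zero Metric.isOpen_ball
      (convex_ball t₀ ε).ordConnected (y := fun i => y (Fin.castSucc i)) (z := y (Fin.last n))
      (fun i => (hs _).mono hVJ) ((hs _).mono hVJ) (fun t ht => (hball ht).2)
      (fun t ht => by rw [hsnoc]; exact hzero t (hVJ ht))
    -- The identity theorem extends this relation from the ball to `J`. Its last coefficient is `1`,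
    -- against independence.
    have han : AnalyticOnNhd ℝ
        (fun t => ∑ i, Fin.snoc (α := fun _ => ℂ) (fun i => -c i) 1 i * y i t) J :=
      Finset.analyticOnNhd_fun_sum _ fun i _ => analyticOnNhd_const.mul (hy i)
    have hz := han.eqOn_zero_of_preconnected_of_eventuallyEq_zero hc.isPreconnected ht₀
      (Filter.eventually_of_mem (Metric.ball_mem_nhds t₀ hε) fun t ht => by
        simp [Fin.sum_univ_castSucc, hcz t ht])
    have := congrFun (hli _ hz) (Fin.last n)
    simp at this

end Analytic

/-! ### Analytic kernels -/

section AnalyticKernel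

variable {F : ℝ → ℝ → ℂ} {I J : Set ℝ}

lemma subset_closure_interior (hI : I.OrdConnected) (hI' : (interior I).Nonempty) :
    I ⊆ closure (interior I) := by
  rw [(hI.convex (𝕜 := ℝ)).closure_interior_eq_closure_of_nonempty_interior hI']
  exact subset_closure

lemma analyticOn_column (hF : AnalyticOn ℝ (Function.uncurry F) (I ×ˢ I)) {t : ℝ} (ht : t ∈ I) :
    AnalyticOn ℝ (fun t' => F t' t) I :=
  AnalyticOn.comp₂ hF analyticOn_id analyticOn_const fun _ ht' => ⟨ht', ht⟩

lemma analyticOn_diag (hF : AnalyticOn ℝ (Function.uncurry F) (I ×ˢ I)) :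
    AnalyticOn ℝ (fun t => F t t) I :=
  AnalyticOn.comp₂ hF analyticOn_id analyticOn_id fun _ ht => ⟨ht, ht⟩

/-- The left factors are columns `F(·, s_i)`: they inherit analyticity from `F`, while the right
factors need no regularity. -/
theorem exists_wronskian_decomposition (hI : I.OrdConnected) (hI' : (interior I).Nonempty)
    (hsep : IsSeparableOn F I) (hF : AnalyticOn ℝ (Function.uncurry F) (I ×ˢ I))
    (hne : ∃ t ∈ I, F t t ≠ 0) :
    ∃ (k : ℕ) (y a : Fin (k + 1) → ℝ → ℂ), (∀ i, AnalyticOn ℝ (y i) I) ∧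
      (∀ t' ∈ I, ∀ t ∈ I, F t' t = ∑ i, a i t * y i t') ∧
      LinearIndependent ℂ (fun i => I.domRestrict (y i)) ∧
      (∃ τ ∈ interior I, wronskian y τ ≠ 0) ∧ StarInverseGivenByAE I F k (wronskianOp y) := by
  obtain ⟨n, s, α, hs, hli, hα⟩ := hsep.exists_columns
  obtain ⟨t₁, ht₁, hne⟩ := hne
  obtain ⟨k, rfl⟩ : ∃ k, n = k + 1 := by
    refine Nat.exists_eq_succ_of_ne_zero ?_
    rintro rfl
    exact hne (by simp [hα t₁ ht₁ t₁ ht₁])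
  have hIint : interior I ⊆ I := interior_subset
  have hopen : IsOpen (interior I) := isOpen_interior
  have hic : (interior I).OrdConnected := hI.interior
  have hy : ∀ i, AnalyticOn ℝ (fun t' => F t' (s i)) I := fun i => analyticOn_column hF (hs i)
  have hyN : ∀ i, AnalyticOnNhd ℝ (fun t' => F t' (s i)) (interior I) := fun i =>
    hopen.analyticOn_iff_analyticOnNhd.1 ((hy i).mono hIint)
  have hW : ∃ τ ∈ interior I, wronskian (fun i t' => F t' (s i)) τ ≠ 0 := by
    refine exists_det_derivMatrix_ne_zero hopen hic hI' hyN fun c hc => ?_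
    -- Independence is known on `I`, Wronskians live on its interior; a relation on the interior
    -- reaches the end points by continuity.
    have h0 : EqOn (fun t' => ∑ i, c i * F t' (s i)) (fun _ => 0) I :=
      Set.EqOn.of_subset_closure (s := interior I) hc
        (continuousOn_finsetSum _ fun i _ => continuousOn_const.mul (hy i).continuousOn)
        continuousOn_const hIint (subset_closure_interior hI hI')
    exact funext (Fintype.linearIndependent_iff.1 hli c (funext fun t => by
      simpa using h0 t.2))
  have hdiag : ∃ t ∈ interior I, F t t ≠ 0 := by
    by_contra! h0
    exact hne (Set.EqOn.of_subset_closure (s := interior I) (g := fun _ => (0 : ℂ)) h0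
      (analyticOn_diag hF).continuousOn continuousOn_const hIint
      (subset_closure_interior hI hI') ht₁)
  refine ⟨k, fun i t' => F t' (s i), α, hy, hα, hli, hW, ?_⟩
  refine starInverseGivenByAE_wronskianOp hI hF.contDiffOn_of_completeSpace hsep
    (fun i => (hy i).contDiffOn_of_completeSpace) hα ?_
  have hn1 := volume_zeros_eq_zero hopen hic
    (hopen.analyticOn_iff_analyticOnNhd.1 ((analyticOn_diag hF).mono hIint)) hdiag
  have hn2 := volume_zeros_eq_zero hopen hic
    (analyticOnNhd_det fun i j => analyticOnNhd_iteratedDeriv (hyN i) j) hW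
  refine measure_mono_null ?_
    (measure_union_null (volume_sdiff_interior hI) (measure_union_null hn1 hn2))
  rintro t ⟨htI, ht⟩
  by_cases hti : t ∈ interior I
  · exact Or.inr (ht.imp (fun h => ⟨hti, h⟩) fun h => ⟨hti, h⟩)
  · exact Or.inl ⟨htI, hti⟩

lemma StarInverseGivenByAE.starInvertibleAE {k : ℕ} {g : ℕ → ℝ → ℂ}
    (h : StarInverseGivenByAE I F k g) : StarInvertibleAE I F := by
  obtain ⟨U, hU, hUo, hnull, hJ⟩ := h
  refine ⟨U, hU, hUo, hnull, fun J hJU hJo hJc => ?_⟩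
  obtain ⟨-, h0, h1⟩ := hJ J hJU hJo hJc
  rcases Nat.eq_zero_or_pos k with hk | hk
  · exact ⟨_, h0 hk⟩
  · obtain ⟨x, -, -, -, hx⟩ := h1 hk
    exact ⟨_, hx⟩

/-! ### Kernels that vanish on the diagonal -/

/-- The kernel of `K ∗ δ'`. -/
def CausalKernel.mulDeriv (K : CausalKernel) : CausalKernel where
  reg := fun t' t => -rightDeriv 1 K.reg t' t
  order := K.order + 1
  sing := fun m t' => Nat.casesOn m (K.reg t' t') fun m => K.sing m t'

lemma CausalKernel.SmoothOn.mulDeriv {K : CausalKernel} (hJ : IsOpen J) (hK : K.SmoothOn J) :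
    K.mulDeriv.SmoothOn J := by
  refine ⟨(contDiffOn_rightDeriv hJ hK.1 1).neg, fun m hm => ?_⟩
  cases m with
  | zero => exact contDiffOn_diag (R := K.reg) hK.1
  | succ m => exact hK.2 m (Nat.lt_of_succ_lt_succ hm)

/-- Integration by parts: the regular part yields `-reg^{(0,1)} Θ` and the boundary term `reg(t',t')
δ`, while each `δ^{(m)}` becomes `δ^{(m+1)}`. -/
lemma CausalKernel.Represents.mulDeriv {K : CausalKernel} (hJ : IsOpen J) (hc : J.OrdConnected)
    (hK : K.SmoothOn J) {S : GenFun J} (hS : K.Represents S) :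
    K.mulDeriv.Represents (S * derivOp hJ) := by
  intro φ t' ht'
  have hreg : ContDiffOn ℝ ∞ (K.reg t') J := contDiffOn_row hK.1 ht'
  have hreg' : ContDiffOn ℝ ∞ (K.mulDeriv.reg t') J := contDiffOn_row (hK.mulDeriv hJ).1 ht'
  have hd : ∀ m, iteratedDeriv m (derivOp hJ φ : ℝ → ℂ) t' =
      iteratedDeriv (m + 1) (φ : ℝ → ℂ) t' := fun m => by
    rw [iteratedDeriv_succ', iteratedDeriv_congr_of_eqOn hJ
      (fun s hs => derivOp_apply hJ φ hs) m ht']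
  rw [Module.End.mul_apply, hS _ t' ht', integral_mul_heaviside_mul hJ hc hreg _ ht',
    integral_mul_heaviside_mul hJ hc hreg' _ ht']
  have h1 := LinearMap.congr_fun (primOp_mul_mulOp_mul_derivOp hJ hc hreg) φ
  simp only [Module.End.mul_apply] at h1
  have h2 : mulOp J (K.mulDeriv.reg t') φ = (-1 : ℂ) • mulOp J (deriv (K.reg t')) φ :=
    causalFun_ext fun t _ => by
      rw [mulOp_apply hreg', Submodule.coe_smul, Pi.smul_apply,
        mulOp_apply (contDiffOn_deriv hJ hreg)]
      simp [CausalKernel.mulDeriv, rightDeriv]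
  rw [h1, h2, map_smul]
  simp only [CausalKernel.mulDeriv, Finset.sum_range_succ', hd]
  simp only [LinearMap.add_apply, LinearMap.smul_apply, Module.End.mul_apply, Submodule.coe_add,
    Pi.add_apply, mulOp_apply hreg, iteratedDeriv_zero]
  change _ = _ + (_ + K.reg t' t' * (φ : ℝ → ℂ) t')
  ring

/-- If `F(t,t) = 0`, then the inverse of `F^{(1,0)} Θ` yields that of `F Θ`. -/
theorem exists_starInverse_of_leftDeriv (hJ : IsOpen J) (hc : J.OrdConnected)
    (hF : ContDiffOn ℝ ∞ (Function.uncurry F) (J ×ˢ J)) (hsep : IsSeparableOn F J)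
    (h0 : ∀ t ∈ J, F t t = 0) (h : ∃ G, IsStarInverse J (thetaKernel (leftDeriv 1 F)) G) :
    ∃ G, IsStarInverse J (thetaKernel F) G := by
  obtain ⟨n, a, b, ha, hb, hab⟩ := hsep.exists_smooth_factors hF
  obtain ⟨G, hG, T₁, S₁, hT₁, hS₁, hST, hTS⟩ := h
  -- The jump term of `derivOp_mul_sepOp` is `F(t,t) = 0`.
  have hT : derivOp hJ * sepOp hJ hc a b = T₁ := by
    rw [derivOp_mul_sepOp hJ hc ha hb]
    have hrep := sepOp_represents hJ hc (fun i => contDiffOn_deriv hJ (ha i)) hb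
      (F := leftDeriv 1 F) fun t' ht' t ht => by
        rw [leftDeriv_sep hJ ha hab 1 ht' ht]; simp only [iteratedDeriv_one]
    refine genFun_ext fun φ t ht => ?_
    rw [hT₁ φ t ht, ← hrep φ t ht, LinearMap.add_apply, Submodule.coe_add, Pi.add_apply,
      mulOp_apply (ContDiffOn.sum fun i _ => (ha i).mul (hb i)), ← hab t ht t ht, h0 t ht,
      zero_mul, zero_add]
  refine ⟨G.mulDeriv, hG.mulDeriv hJ, sepOp hJ hc a b, S₁ * derivOp hJ,
    sepOp_represents hJ hc ha hb hab, hS₁.mulDeriv hJ hc hG, by rw [mul_assoc, hT, hST], ?_⟩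
  -- With `T` for `F Θ`: `T S₁ = P D T S₁ = P T₁ S₁ = P`, so `T (S₁ D) = P D = 1`. Surjectivity of
  -- `T` follows here instead of being needed.
  have h1 : sepOp hJ hc a b * S₁ = primOp hJ hc := by
    rw [← one_mul (sepOp hJ hc a b), ← primOp_mul_derivOp hJ hc, mul_assoc (primOp hJ hc), hT,
      mul_assoc, hTS, mul_one]
  rw [← mul_assoc, h1, primOp_mul_derivOp]

/-- Either the diagonal is not identically null and the Wronskian applies, or `F` is replaced by
`F^{(1,0)}`, which is again analytic and separable and lowers `m` by one. -/
theorem starInvertibleAE_of_leftDeriv_ne_zero (hJ : IsOpen J) (hc : J.OrdConnected) (m : ℕ)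
    (hF : AnalyticOn ℝ (Function.uncurry F) (J ×ˢ J)) (hsep : IsSeparableOn F J)
    (hm : ∃ t ∈ J, leftDeriv m F t t ≠ 0) : StarInvertibleAE J F := by
  induction m generalizing F with
  | zero =>
    obtain ⟨t, ht, -⟩ := id hm
    obtain ⟨k, y, a, -, -, -, -, h⟩ := exists_wronskian_decomposition hc
      (by rw [hJ.interior_eq]; exact ⟨t, ht⟩) hsep hF (by simpa [leftDeriv] using hm)
    exact h.starInvertibleAE
  | succ m ih =>
    obtain ⟨t, ht, hmt⟩ := hm
    by_cases hdiag : ∃ t ∈ J, F t t ≠ 0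
    · obtain ⟨k, y, a, -, -, -, -, h⟩ := exists_wronskian_decomposition hc
        (by rw [hJ.interior_eq]; exact ⟨t, ht⟩) hsep hF hdiag
      exact h.starInvertibleAE
    push Not at hdiag
    have hFs : ContDiffOn ℝ ∞ (Function.uncurry F) (J ×ˢ J) := hF.contDiffOn_of_completeSpace
    have hFN := (hJ.prod hJ).analyticOn_iff_analyticOnNhd.1 hF
    have hF1 : AnalyticOn ℝ (Function.uncurry (leftDeriv 1 F)) (J ×ˢ J) := by
      refine AnalyticOn.congr (f := fun z => fderiv ℝ (Function.uncurry F) z (1, 0))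
        ((ContinuousLinearMap.apply ℝ ℂ ((1, 0) : ℝ × ℝ)).comp_analyticOnNhd
          hFN.fderiv).analyticOn ?_
      intro z hz
      change _ = fderiv ℝ (Function.uncurry F) (z.1, z.2) (1, 0)
      rw [← deriv_left_eq_fderiv hJ hFs hz.1 hz.2]
      simp [leftDeriv, Function.uncurry]
    have hsep1 : IsSeparableOn (leftDeriv 1 F) J := by
      obtain ⟨n, a, b, ha, -, hab⟩ := hsep.exists_smooth_factors hFs
      exact ⟨n, _, b, fun t' ht' t ht => leftDeriv_sep hJ ha hab 1 ht' ht⟩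
    obtain ⟨U, hU, hUo, hnull, h⟩ := ih hF1 hsep1 ⟨t, ht, by
      simpa [leftDeriv, iteratedDeriv_succ'] using hmt⟩
    exact ⟨U, hU, hUo, hnull, fun K hKU hK hKc => exists_starInverse_of_leftDeriv hK hKc
      (hFs.mono (prod_mono (hKU.trans hU) (hKU.trans hU))) (hsep.mono (hKU.trans hU))
      (fun t ht => hdiag t (hU (hKU ht))) (h K hKU hK hKc)⟩

/-- A non-null analytic separable kernel is invertible almost everywhere. -/
theorem starInvertibleAE_of_analyticOn (hI : I.OrdConnected) (hI' : (interior I).Nonempty)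
    (hF : AnalyticOn ℝ (Function.uncurry F) (I ×ˢ I)) (hsep : IsSeparableOn F I)
    (hne : ∃ t' ∈ I, ∃ t ∈ I, F t' t ≠ 0) : StarInvertibleAE I F := by
  have hIint : interior I ⊆ I := interior_subset
  have hopen : IsOpen (interior I) := isOpen_interior
  have hFi : AnalyticOn ℝ (Function.uncurry F) (interior I ×ˢ interior I) :=
    hF.mono (prod_mono hIint hIint)
  obtain ⟨t', ht', t, ht, hne⟩ : ∃ t' ∈ interior I, ∃ t ∈ interior I, F t' t ≠ 0 := by
    by_contra! h0
    obtain ⟨t', ht', t, ht, hne⟩ := hne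
    refine hne (Set.EqOn.of_subset_closure (s := interior I ×ˢ interior I) (t := I ×ˢ I)
      (f := Function.uncurry F) (g := fun _ => 0) (fun z hz => h0 z.1 hz.1 z.2 hz.2)
      hF.continuousOn continuousOn_const (prod_mono hIint hIint) ?_
      (show (t', t) ∈ I ×ˢ I from ⟨ht', ht⟩))
    rw [closure_prod_eq]
    exact prod_mono (subset_closure_interior hI hI') (subset_closure_interior hI hI')
  -- The column through `t` is not null. If all its derivatives vanished at the diagonal point, it
  -- would have infinite order there and be null by the identity theorem.
  obtain ⟨m, hm⟩ : ∃ m, leftDeriv m F t t ≠ 0 := by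
    by_contra! h0
    have han : AnalyticOnNhd ℝ (fun s => F s t) (interior I) :=
      hopen.analyticOn_iff_analyticOnNhd.1 (analyticOn_column hFi ht)
    have htop : analyticOrderAt (fun s => F s t) t = ⊤ := by
      refine ENat.eq_top_iff_forall_ge.2 fun n => ?_
      exact (natCast_le_analyticOrderAt_iff_iteratedDeriv_eq_zero (han t ht)).2 fun i _ => h0 i
    exact hne (han.eqOn_zero_of_preconnected_of_eventuallyEq_zero hI.interior.isPreconnected ht
      (analyticOrderAt_eq_top.1 htop) ht')
  obtain ⟨U, hU, hUo, hnull, h⟩ := starInvertibleAE_of_leftDeriv_ne_zero hopen hI.interior m hFi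
    (hsep.mono hIint) ⟨t, ht, hm⟩
  refine ⟨U, hU.trans hIint, hUo, ?_, h⟩
  refine measure_mono_null (fun t ht => ?_) (measure_union_null (volume_sdiff_interior hI) hnull)
  by_cases hti : t ∈ interior I
  · exact Or.inr ⟨hti, ht.2⟩
  · exact Or.inl ⟨ht.1, hti⟩

/-- A kernel that represents a non-null generalized function is not identically null. -/
lemma exists_ne_zero_of_represents {T : GenFun J} (hJ : IsOpen J)
    (hT : (thetaKernel F).Represents T) (hne : T ≠ 0) : ∃ t' ∈ J, ∃ t ∈ J, F t' t ≠ 0 := by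
  by_contra! h0
  refine hne (genFun_ext fun φ t' ht' => ?_)
  rw [hT φ t' ht', setIntegral_congr_fun (g := fun _ => 0) hJ.measurableSet
    fun τ hτ => by simp [thetaKernel, h0 t' ht' τ hτ]]
  simp [thetaKernel]

end AnalyticKernel

end StarInverse

end

open StarInverse in
theorem corollary2p1 (I : Set ℝ) (hI : I.OrdConnected) (hI' : (interior I).Nonempty)
    (F : ℝ → ℝ → ℂ) (hF : ContDiffOn ℝ ∞ (Function.uncurry F) (I ×ˢ I))
    (hsep : IsSeparableOn F I) :
    -- every operator annihilating `F` on an open interval yields the inverse there, where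
    -- `F(τ,τ)` and the leading coefficient do not vanish
    (∀ J ⊆ I, IsOpen J → J.OrdConnected → ∀ (k : ℕ) (g : ℕ → ℝ → ℂ), IsAnnihilator J F k g →
      (∀ τ ∈ J, F τ τ ≠ 0 ∧ g (k + 1) τ ≠ 0) → StarInverseGivenBy J F k g) ∧
    -- smooth left factors: their Wronskian yields an annihilating operator, and the inverse where
    -- `F(τ,τ)` and the Wronskian do not vanish
    (∀ (k : ℕ) (y a : Fin (k + 1) → ℝ → ℂ), (∀ i, ContDiffOn ℝ ∞ (y i) I) →
      (∀ t' ∈ I, ∀ t ∈ I, F t' t = ∑ i, a i t * y i t') →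
      IsAnnihilator (interior I) F k (wronskianOp y) ∧
      (MeasureTheory.volume {τ ∈ I | F τ τ = 0 ∨ wronskian y τ = 0} = 0 →
        StarInverseGivenByAE I F k (wronskianOp y))) ∧
    -- analytic `F` with `F(t,t)` not identically null: the inverse exists almost everywhere
    (AnalyticOn ℝ (Function.uncurry F) (I ×ˢ I) → (∃ t ∈ I, F t t ≠ 0) →
      ∃ (k : ℕ) (y a : Fin (k + 1) → ℝ → ℂ), (∀ i, AnalyticOn ℝ (y i) I) ∧
        (∀ t' ∈ I, ∀ t ∈ I, F t' t = ∑ i, a i t * y i t') ∧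
        LinearIndependent ℂ (fun i => I.domRestrict (y i)) ∧
        (∃ τ ∈ interior I, wronskian y τ ≠ 0) ∧
        StarInverseGivenByAE I F k (wronskianOp y)) ∧
    -- analytic `F` not identically null
    (AnalyticOn ℝ (Function.uncurry F) (I ×ˢ I) → (∃ t' ∈ I, ∃ t ∈ I, F t' t ≠ 0) →
      StarInvertibleAE I F) ∧
    -- the `∗`-Lanczos algorithm: a coefficient `β_n` of the conjectured form is null or invertible
    (∀ J ⊆ I, IsOpen J → J.OrdConnected →
      ∀ (N : ℕ) (M : Matrix (Fin N) (Fin N) (ℝ → ℂ)) (A : Matrix (Fin N) (Fin N) (GenFun J))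
        (w v : Fin N → ℂ), (∀ p q, ContDiffOn ℝ ∞ (M p q) J) →
      (∀ p q, (thetaKernel (fun t' _ => M p q t')).Represents (A p q)) →
      star w ⬝ᵥ v = 1 → ∀ n, 1 ≤ n → LanczosReaches A w v n →
      ∀ B : ℝ → ℝ → ℂ, (thetaKernel B).Represents (lanczos A w v n).β →
      AnalyticOn ℝ (Function.uncurry B) (J ×ˢ J) → IsSeparableOn B J →
      (lanczos A w v n).β ≠ 0 → StarInvertibleAE J B) := by
  refine ⟨fun J hJI hJ hJc k g hg hne => ?_, fun k y a hy hFy => ⟨?_, fun hnull => ?_⟩,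
    fun hFa hne => ?_, fun hFa hne => ?_, ?_⟩
  · exact starInverseGivenBy hJ hJc (hF.mono (Set.prod_mono hJI hJI)) (hsep.mono hJI) hg hne
  · exact isAnnihilator_wronskianOp isOpen_interior (fun i => (hy i).mono interior_subset)
      fun t' ht' t ht => hFy t' (interior_subset ht') t (interior_subset ht)
  · exact starInverseGivenByAE_wronskianOp hI hF hsep hy hFy hnull
  · exact exists_wronskian_decomposition hI hI' hsep hFa hne
  · exact starInvertibleAE_of_analyticOn hI hI' hFa hsep hne
  · intro J _ hJ hJc N M A w v _ _ _ n _ _ B hB hBa hBs hne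
    -- A non-null `β_n` gives a point where its kernel `B` is non-zero; the same point shows that
    -- `J` is non-empty.
    have h := exists_ne_zero_of_represents hJ hB hne
    obtain ⟨t, ht, -⟩ := id h
    exact starInvertibleAE_of_analyticOn hJc (by rw [hJ.interior_eq]; exact ⟨t, ht⟩) hBa hBs h
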